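/- **Heterogeneous mappings.** A mapping $\mathcal F:\mathbb R^{n_x}\to\mathbb R^{n_F\times m_F}$ is *heterogeneous of degree* $\ell\ge1$ ($\ell$ an integer), with witnesses $\Pi,\Xi,\mathcal T$, if $\Pi(\omega)\in\mathbb R^{n_F\times n_F}$, $\Xi(\omega)\in\mathbb R^{d\times n_x}$ has entries $c_{ij}\omega^{\ell_{ij}}$ with $c_{ij}\in\{0,1\}$ and integers $\ell_{ij}>0$, $\mathcal T:\mathbb R^d\to\mathbb R^{n_F\times m_F}$, and $\Pi(\omega)\mathcal F(x)=\mathcal T(\Xi(\omega)x)$, $\det\Pi(\omega)\ge\omega^{\ell}$ for all $\omega\in\mathbb R$, $x\in\mathbb R^{n_x}$. Write $\overline\Xi(\omega)=(c_{ij}\omega^{\ell_{ij}-1})$, so $\Xi(\omega)=\omega\,\overline\Xi(\omega)$. **System.** Let $\theta\in\mathbb R^{n_\theta}$ be an unknown constant vector and, for $t\ge t_0$, $$\dot x=A(\theta)x+B(\theta)u=\Phi^{T}(x,u)\Theta_{AB}(\theta),\qquad \dot\xi=A_0\xi+\psi_a(\theta)y+\psi_b(\theta)u,\qquad y=\mathcal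 C^{T}x=C_0^{T}\xi,$$ with $x,\xi\in\mathbb R^n$, $u,y\in\mathbb R$, $A_0$ the upper shift matrix, $C_0=(1,0,\dots,0)^T$, $\Phi^T(x,u)=[\,I_n\otimes x^T\;\; I_n\otimes u\,]\mathcal D_\Phi$ and $\Theta_{AB}(\theta)=\mathcal L_\Phi[\mathrm{vec}^T(A^T(\theta))\;\;B^T(\theta)]^T\in\mathbb R^{n_\Theta}$, where the known matrices $\mathcal D_\Phi,\mathcal L_\Phi$ satisfy $\mathcal D_\Phi\Theta_{AB}(\theta)=[\mathrm{vec}^T(A^T(\theta))\;\;B^T(\theta)]^T$. Put $\psi_{ab}(\theta)=\mathcal L_{ab}[\psi_a^T(\theta)\;\psi_b^T(\theta)]^T\in\mathbb R^{n_\theta}$ with a known matrix $\mathcal L_{ab}$. Differential equations are understood in the Carathéodory sense. **Assumptions.** 1. The trajectories $x$ and $\xi$ exist and are bounded on $[t_0,\infty)$. 2. $\Theta_{AB}$ is heterogeneous with known witnesses $\Pi_\Theta,\Xi_\Theta,\mathcal T_\Theta$, and $\Pi_\Theta(\omega)$ is nonsingular for $\omega<0$. 3. $\psi_{ab}$ is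 differentiable at $\theta$ with $\det^2\{\nabla_\theta\psi_{ab}(\theta)\}>0$, and there are known heterogeneous mappings $\mathcal G:\mathbb R^{n_\theta}\to\mathbb R^{n_\theta\times n_\theta}$ and $\mathcal S:\mathbb R^{n_\theta}\to\mathbb R^{n_\theta}$, with known witnesses $(\Pi_\theta,\Xi_{\mathcal G},\mathcal T_{\mathcal G})$ and $(\Pi_\theta,\Xi_{\mathcal S},\mathcal T_{\mathcal S})$ (same $\Pi_\theta$ and degree), such that $\mathcal S(\psi_{ab}(\theta))=\mathcal G(\psi_{ab}(\theta))\theta$ and $\mathrm{rank}\,\mathcal G(\psi_{ab}(\theta))=n_\theta$. 4. There is $L(\theta)\in\mathbb R^n$ with $\det\{sI_n-A(\theta)+L(\theta)\mathcal C^T\}=(s+a_m)^n$, $a_m>0$ known, and there are known heterogeneous mappings $\mathcal P:\mathbb R^{n_\theta}\to\mathbb R^{n\times n}$ and $\mathcal Q:\mathbb R^{n_\theta+n}\to\mathbb R^n$, with known witnesses $(\Pi_L,\Xi_{\mathcal P},\mathcal T_{\mathcal P})$ and $(\Pi_L,\Xi_{\mathcal Q},\mathcal T_{\mathcal Q})$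 (same $\Pi_L$ and degree), such that $\mathcal Q(\vartheta)=\mathcal P(\theta)L(\theta)$ and $\mathrm{rank}\,\mathcal P(\theta)=n$, where $\vartheta=[\theta^T\;\;\psi_{a_m}^T(a_m)]^T$ and $\psi_{a_m}(a_m)\in\mathbb R^n$ is a known vector; moreover $\Pi_L(\omega)$ is nonsingular for $\omega<0$. **Filters.** Let $K\in\mathbb R^n$ be such that $A_K=A_0-KC_0^T$ is Hurwitz, let $k,\sigma>0$, and let $$\dot z=A_Kz+Ky,\quad \dot\Omega=A_K\Omega+I_ny,\quad \dot P=A_KP+I_nu,$$ with zero initial conditions at $t_0$. Put $q=y-C_0^Tz$, $\varphi=\big[(\Omega^TC_0)^T\;\;(P^TC_0)^T\;\;-(e^{A_K^T(t-t_0)}C_0)^T\big]^T\in\mathbb R^{3n}$, $$\dot{\overline q}=e^{-\sigma(t-t_0)}\varphi q,\qquad \dot{\overline\varphi}=e^{-\sigma(t-t_0)}\varphi\varphi^T,\qquad \overline q(t_0)=0,\ \overline\varphi(t_0)=0,$$ $\Delta=k\det\overline\varphi$ and $\mathcal Y=k\,\mathcal L_{ab}[I_{2n}\;0_{2n\times n}]\,\mathrm{adj}\{\overline\varphi\}\,\overline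 q$, and $$\mathcal M_\theta=\det\{\mathcal T_{\mathcal G}(\overline\Xi_{\mathcal G}(\Delta)\mathcal Y)\},\quad \mathcal Y_\theta=\mathrm{adj}\{\mathcal T_{\mathcal G}(\overline\Xi_{\mathcal G}(\Delta)\mathcal Y)\}\,\mathcal T_{\mathcal S}(\overline\Xi_{\mathcal S}(\Delta)\mathcal Y),\quad \mathcal Y_\vartheta=[\mathcal Y_\theta^T\;\;\mathcal M_\theta\psi_{a_m}^T(a_m)]^T,$$ $$\mathcal M_{AB}=\det\Pi_\Theta(\mathcal M_\theta),\quad \mathcal Y_{AB}=\mathrm{adj}\{\Pi_\Theta(\mathcal M_\theta)\}\,\mathcal T_\Theta(\overline\Xi_\Theta(\mathcal M_\theta)\mathcal Y_\theta),$$ $$\mathcal M_L=\det\{\mathcal T_{\mathcal P}(\overline\Xi_{\mathcal P}(\mathcal M_\theta)\mathcal Y_\theta)\},\quad \mathcal Y_L=\mathrm{adj}\{\mathcal T_{\mathcal P}(\overline\Xi_{\mathcal P}(\mathcal M_\theta)\mathcal Y_\theta)\}\,\mathcal T_{\mathcal Q}(\overline\Xi_{\mathcal Q}(\mathcal M_\theta)\mathcal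 Y_\vartheta).$$ **Adaptive observer.** Let $\gamma_0,\gamma_1>0$. With $\hat y=\mathcal C^T\hat x$, $\tilde y=\hat y-y$ and $\Phi=\Phi(\hat x,u)$, $$\dot{\hat x}=\Phi^T(\hat x,u)\hat\Theta_{AB}-\hat L\tilde y,\quad \dot{\hat\Theta}_{AB}=-\gamma_\Theta\mathcal M_{AB}[\mathcal M_{AB}\hat\Theta_{AB}-\mathcal Y_{AB}],\quad \dot{\hat L}=-\gamma_L\mathcal M_L[\mathcal M_L\hat L-\mathcal Y_L],$$ where $\gamma_\Theta=\gamma_L=0$ if $\Delta(t)<\rho$, and otherwise $\gamma_\Theta=\big(\gamma_1+\gamma_0\lambda_{\max}(\Phi\Phi^T)\big)/\mathcal M_{AB}^2$, $\gamma_L=(\gamma_1+\gamma_0\tilde y^2)/\mathcal M_L^2$. **Theorem.** Suppose that Assumptions 1-4 hold and that $\varphi$ is finitely exciting: $\int_{t_r}^{t_e}\varphi(\tau)\varphi^T(\tau)\,d\tau\ge\alpha I_{3n}$ for some $t_e>t_r\ge t_0$ and $\alpha>0$. Then $\Delta(t)\ge\Delta(t_e)>0$ for all $t\ge t_e$, and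 there is a rate $\kappa>0$, independent of the threshold $\rho$ and of the initial values of the observer, such that for every threshold $\rho>0$ with $\rho\le\Delta(t)$ for some $t\ge t_0$, every solution $(\hat x,\hat\Theta_{AB},\hat L)$ of the adaptive observer on $[t_0,\infty)$ satisfies, for some constant $c$, $$\|\hat x(t)-x(t)\|\le c\,e^{-\kappa(t-t_0)},\qquad \|\hat\Theta_{AB}(t)-\Theta_{AB}(\theta)\|\le c\,e^{-\kappa(t-t_0)}\qquad\text{for all }t\ge t_0.$$ -/

import Mathlib

open scoped Matrix

noncomputable section

namespace AdaptiveObserver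

/-! ### Ordinary differential equations -/

/-- `f` solves `f' = g` on `[t₀, ∞)` in the sense of Carathéodory: `g` is locally integrable and
`f` is its indefinite integral. Vector and matrix equations are read entry by entry. -/
def HasRateFrom (t₀ : ℝ) (f g : ℝ → ℝ) : Prop :=
  ∀ t, t₀ ≤ t → IntervalIntegrable g MeasureTheory.volume t₀ t ∧ f t = f t₀ + ∫ τ in t₀..t, g τ

/-! ### Linear algebra -/

/-- All (complex) eigenvalues have negative real part. -/
def IsHurwitz {n : ℕ} (M : Matrix (Fin n) (Fin n) ℝ) : Prop :=
  ∀ s ∈ spectrum ℂ (M.map Complex.ofReal), s.re < 0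

/-- The largest eigenvalue of a real symmetric matrix. -/
def lambdaMax {m : ℕ} (M : Matrix (Fin m) (Fin m) ℝ) : ℝ := sSup (spectrum ℝ M)

/-! ### Heterogeneous mappings -/

/-- A matrix `Ξ(ω)` with entries `c i j * ω ^ (ℓ i j)`, `c i j ∈ {0, 1}`, `ℓ i j > 0`. -/
structure PowerMatrix (δ ι : Type) where
  c : δ → ι → ℝ
  ℓ : δ → ι → ℕ
  c_mem : ∀ i j, c i j = 0 ∨ c i j = 1
  ℓ_pos : ∀ i j, 0 < ℓ i j

/-- `Ξ(ω)`. -/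
def PowerMatrix.full {δ ι : Type} (Ξ : PowerMatrix δ ι) (ω : ℝ) : Matrix δ ι ℝ :=
  Matrix.of fun i j => Ξ.c i j * ω ^ (Ξ.ℓ i j)

/-- `Ξ̄(ω)`, the matrix with `Ξ(ω) = ω Ξ̄(ω)`. -/
def PowerMatrix.bar {δ ι : Type} (Ξ : PowerMatrix δ ι) (ω : ℝ) : Matrix δ ι ℝ :=
  Matrix.of fun i j => Ξ.c i j * ω ^ (Ξ.ℓ i j - 1)

theorem PowerMatrix.full_eq_smul_bar {δ ι : Type} (Ξ : PowerMatrix δ ι) (ω : ℝ) :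
    Ξ.full ω = ω • Ξ.bar ω := by
  ext i j
  obtain ⟨k, hk⟩ : ∃ k, Ξ.ℓ i j = k + 1 := Nat.exists_eq_succ_of_ne_zero (Ξ.ℓ_pos i j).ne'
  simp [PowerMatrix.full, PowerMatrix.bar, hk, pow_succ]
  ring

/-- The matrix-valued mapping `F` is heterogeneous of degree `ℓ`, with witnesses `Pi`, `Ξ`, `T`:
`Pi(ω) F(x) = T(Ξ(ω) x)` and `det Pi(ω) ≥ ω ^ ℓ` for all `ω` and `x`. -/
def IsHeterogeneous {ι δ : Type} [Fintype ι] {r s : ℕ}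
    (F : (ι → ℝ) → Matrix (Fin r) (Fin s) ℝ) (Pi : ℝ → Matrix (Fin r) (Fin r) ℝ)
    (Ξ : PowerMatrix δ ι) (T : (δ → ℝ) → Matrix (Fin r) (Fin s) ℝ) (ℓ : ℕ) : Prop :=
  1 ≤ ℓ ∧ (∀ (ω : ℝ) (x : ι → ℝ), Pi ω * F x = T (Ξ.full ω *ᵥ x)) ∧
    ∀ ω : ℝ, ω ^ ℓ ≤ (Pi ω).det

/-- Heterogeneity of a vector-valued mapping, regarded as a one-column matrix. -/
def IsHeterogeneousVec {ι δ : Type} [Fintype ι] {r : ℕ}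
    (F : (ι → ℝ) → Fin r → ℝ) (Pi : ℝ → Matrix (Fin r) (Fin r) ℝ)
    (Ξ : PowerMatrix δ ι) (T : (δ → ℝ) → Fin r → ℝ) (ℓ : ℕ) : Prop :=
  IsHeterogeneous (s := 1) (fun x => Matrix.replicateCol (Fin 1) (F x)) Pi Ξ
    (fun v => Matrix.replicateCol (Fin 1) (T v)) ℓ

/-! ### The class of systems -/

/-- The known matrices and mappings which describe the class of systems: `n` states, `nθ` unique
parameters `θ`, `nΘ` overparametrized parameters. -/
structure SystemClass (n nθ nΘ : ℕ) where
  A : (Fin nθ → ℝ) → Matrix (Fin n) (Fin n) ℝ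
  B : (Fin nθ → ℝ) → Fin n → ℝ
  /-- output vector -/
  outC : Fin n → ℝ
  ψa : (Fin nθ → ℝ) → Fin n → ℝ
  ψb : (Fin nθ → ℝ) → Fin n → ℝ
  /-- elimination matrix from `(ψa, ψb)` to `ψab` -/
  Lab : Matrix (Fin nθ) (Fin n ⊕ Fin n) ℝ
  /-- duplication matrix -/
  Dphi : Matrix ((Fin n × Fin n) ⊕ Fin n) (Fin nΘ) ℝ
  /-- elimination matrix -/
  Lphi : Matrix (Fin nΘ) ((Fin n × Fin n) ⊕ Fin n) ℝ

/-- `[I ⊗ xᵀ, I ⊗ u]`. -/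
def kronRegressor {n : ℕ} (x : Fin n → ℝ) (u : ℝ) :
    Matrix (Fin n) ((Fin n × Fin n) ⊕ Fin n) ℝ :=
  Matrix.of fun i => Sum.elim (fun p => if p.1 = i then x p.2 else 0) (fun k => if k = i then u else 0)

namespace SystemClass

variable {n nθ nΘ : ℕ}

/-- The stacked vector `[vec(A(θ)ᵀ); B(θ)]` (the rows of `A(θ)` one after another, then `B(θ)`). -/
def stackAB (sys : SystemClass n nθ nΘ) (θ : Fin nθ → ℝ) : (Fin n × Fin n) ⊕ Fin n → ℝ :=
  Sum.elim (fun p => sys.A θ p.1 p.2) (sys.B θ)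

/-- `Θ_AB(θ)`. -/
def ΘAB (sys : SystemClass n nθ nΘ) (θ : Fin nθ → ℝ) : Fin nΘ → ℝ := sys.Lphi *ᵥ sys.stackAB θ

/-- `ψ_ab(θ)`. -/
def ψab (sys : SystemClass n nθ nΘ) (θ : Fin nθ → ℝ) : Fin nθ → ℝ :=
  sys.Lab *ᵥ Sum.elim (sys.ψa θ) (sys.ψb θ)

/-- `Φᵀ(x, u)`. -/
def ΦT (sys : SystemClass n nθ nΘ) (x : Fin n → ℝ) (u : ℝ) : Matrix (Fin n) (Fin nΘ) ℝ :=
  kronRegressor x u * sys.Dphi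

end SystemClass

/-- The shift matrix `A₀`. -/
def shiftA (n : ℕ) : Matrix (Fin n) (Fin n) ℝ :=
  Matrix.of fun i j => if (j : ℕ) = (i : ℕ) + 1 then 1 else 0

/-- The vector `C₀ = (1, 0, …, 0)`. -/
def firstC (n : ℕ) : Fin n → ℝ := fun i => if (i : ℕ) = 0 then 1 else 0

/-- `A_K = A₀ - K C₀ᵀ`. -/
def filterA {n : ℕ} (K : Fin n → ℝ) : Matrix (Fin n) (Fin n) ℝ :=
  shiftA n - Matrix.vecMulVec K (firstC n)

/-- `x`, `ξ`, `y` are trajectories on `[t₀, ∞)` of the system with parameter `θ` and control `u`: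
`x' = A(θ) x + B(θ) u`, `ξ' = A₀ ξ + ψa(θ) y + ψb(θ) u`, `y = 𝒞ᵀ x = C₀ᵀ ξ`. -/
structure IsTrajectory {n nθ nΘ : ℕ} (sys : SystemClass n nθ nΘ) (θ : Fin nθ → ℝ) (t₀ : ℝ)
    (u y : ℝ → ℝ) (x ξ : ℝ → Fin n → ℝ) : Prop where
  state : ∀ i, HasRateFrom t₀ (fun t => x t i) (fun t => (sys.A θ *ᵥ x t + u t • sys.B θ) i)
  obsState : ∀ i, HasRateFrom t₀ (fun t => ξ t i)
    (fun t => (shiftA n *ᵥ ξ t + y t • sys.ψa θ + u t • sys.ψb θ) i)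
  output_state : ∀ t, t₀ ≤ t → y t = sys.outC ⬝ᵥ x t
  output_obsState : ∀ t, t₀ ≤ t → y t = firstC n ⬝ᵥ ξ t

/-! ### The known mappings used by the observer -/

/-- The known mappings (data only; what is assumed about them is stated below). -/
structure KnownMaps (n nθ nΘ : ℕ) where
  (dΘ dG dS dP dQ : ℕ)
  -- heterogeneity of `Θ_AB`
  PiΘ : ℝ → Matrix (Fin nΘ) (Fin nΘ) ℝ
  ΞΘ : PowerMatrix (Fin dΘ) (Fin nθ)
  TΘ : (Fin dΘ → ℝ) → Fin nΘ → ℝ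
  ℓΘ : ℕ
  -- from `ψ_ab` to `θ`
  G : (Fin nθ → ℝ) → Matrix (Fin nθ) (Fin nθ) ℝ
  S : (Fin nθ → ℝ) → Fin nθ → ℝ
  Piθ : ℝ → Matrix (Fin nθ) (Fin nθ) ℝ
  ΞG : PowerMatrix (Fin dG) (Fin nθ)
  TG : (Fin dG → ℝ) → Matrix (Fin nθ) (Fin nθ) ℝ
  ΞS : PowerMatrix (Fin dS) (Fin nθ)
  TS : (Fin dS → ℝ) → Fin nθ → ℝ
  ℓθ : ℕ
  -- from `ϑ = (θ, ψ_am(a_m))` to the Luenberger gain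
  ψam : ℝ → Fin n → ℝ
  P : (Fin nθ → ℝ) → Matrix (Fin n) (Fin n) ℝ
  Q : (Fin nθ ⊕ Fin n → ℝ) → Fin n → ℝ
  PiL : ℝ → Matrix (Fin n) (Fin n) ℝ
  ΞP : PowerMatrix (Fin dP) (Fin nθ)
  TP : (Fin dP → ℝ) → Matrix (Fin n) (Fin n) ℝ
  ΞQ : PowerMatrix (Fin dQ) (Fin nθ ⊕ Fin n)
  TQ : (Fin dQ → ℝ) → Fin n → ℝ
  ℓL : ℕ

/-- `Θ_AB` is heterogeneous, with known witnesses. -/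
structure ThetaHeterogeneous {n nθ nΘ : ℕ} (sys : SystemClass n nθ nΘ)
    (m : KnownMaps n nθ nΘ) : Prop where
  het : IsHeterogeneousVec sys.ΘAB m.PiΘ m.ΞΘ m.TΘ m.ℓΘ
  nonsing : ∀ ω < 0, (m.PiΘ ω).det ≠ 0

/-- The identifiability condition at `θ`, and the known heterogeneous mappings `G`, `S` with
`S(ψ_ab) = G(ψ_ab) θ` and `rank G(ψ_ab) = nθ`. -/
structure Identifiable {n nθ nΘ : ℕ} (sys : SystemClass n nθ nΘ) (m : KnownMaps n nθ nΘ)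
    (θ : Fin nθ → ℝ) : Prop where
  diff : DifferentiableAt ℝ sys.ψab θ
  jacobian : 0 < (fderiv ℝ sys.ψab θ).det ^ 2
  hetG : IsHeterogeneous m.G m.Piθ m.ΞG m.TG m.ℓθ
  hetS : IsHeterogeneousVec m.S m.Piθ m.ΞS m.TS m.ℓθ
  eq : m.S (sys.ψab θ) = m.G (sys.ψab θ) *ᵥ θ
  rankG : (m.G (sys.ψab θ)).rank = nθ

/-- The vector `L` is a Luenberger gain with `det(s I - A(θ) + L 𝒞ᵀ) = (s + a_m)ⁿ`, and the known
heterogeneous mappings `P`, `Q` satisfy `Q(ϑ) = P(θ) L`, `rank P(θ) = n`. -/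
structure LuenbergerGain {n nθ nΘ : ℕ} (sys : SystemClass n nθ nΘ) (m : KnownMaps n nθ nΘ)
    (am : ℝ) (θ : Fin nθ → ℝ) (L : Fin n → ℝ) : Prop where
  charpoly : (sys.A θ - Matrix.vecMulVec L sys.outC).charpoly =
    (Polynomial.X + Polynomial.C am) ^ n
  hetP : IsHeterogeneous m.P m.PiL m.ΞP m.TP m.ℓL
  hetQ : IsHeterogeneousVec m.Q m.PiL m.ΞQ m.TQ m.ℓL
  nonsing : ∀ ω < 0, (m.PiL ω).det ≠ 0
  eq : m.Q (Sum.elim θ (m.ψam am)) = m.P θ *ᵥ L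
  rankP : (m.P θ).rank = n

/-! ### Filters and regression equations -/

/-- The filters `z`, `Ω`, `P` driven by `y` and `u`, with zero initial conditions. -/
structure IsFilter {n : ℕ} (K : Fin n → ℝ) (t₀ : ℝ) (u y : ℝ → ℝ) (z : ℝ → Fin n → ℝ)
    (Ω Pf : ℝ → Matrix (Fin n) (Fin n) ℝ) : Prop where
  z_init : z t₀ = 0
  Ω_init : Ω t₀ = 0
  Pf_init : Pf t₀ = 0
  z_rate : ∀ i, HasRateFrom t₀ (fun t => z t i) (fun t => (filterA K *ᵥ z t + y t • K) i)
  Ω_rate : ∀ i j, HasRateFrom t₀ (fun t => Ω t i j)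
    (fun t => (filterA K * Ω t + y t • (1 : Matrix (Fin n) (Fin n) ℝ)) i j)
  Pf_rate : ∀ i j, HasRateFrom t₀ (fun t => Pf t i j)
    (fun t => (filterA K * Pf t + u t • (1 : Matrix (Fin n) (Fin n) ℝ)) i j)

/-- Indices of the `3n`-dimensional regressor. -/
abbrev RegIdx (n : ℕ) : Type := (Fin n ⊕ Fin n) ⊕ Fin n

/-- `q = y - C₀ᵀ z`. -/
def qSignal {n : ℕ} (y : ℝ → ℝ) (z : ℝ → Fin n → ℝ) (t : ℝ) : ℝ := y t - firstC n ⬝ᵥ z t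

/-- The regressor `φ = (Ωᵀ C₀, Pᵀ C₀, -(e^{A_K (t - t₀)})ᵀ C₀)`. -/
def regressor {n : ℕ} (K : Fin n → ℝ) (t₀ : ℝ) (Ω Pf : ℝ → Matrix (Fin n) (Fin n) ℝ) (t : ℝ) :
    RegIdx n → ℝ :=
  Sum.elim (Sum.elim ((Ω t)ᵀ *ᵥ firstC n) ((Pf t)ᵀ *ᵥ firstC n))
    (-((NormedSpace.exp ((t - t₀) • filterA K))ᵀ *ᵥ firstC n))

/-- Finite excitation over `[tr, te]`: `∫ ω ωᵀ ≥ α I` for some `α > 0`. -/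
def FinitelyExciting {ι : Type} [Fintype ι] [DecidableEq ι] (t₀ tr te : ℝ) (ω : ℝ → ι → ℝ) :
    Prop :=
  t₀ ≤ tr ∧ tr < te ∧ ∃ α : ℝ, 0 < α ∧
    ((Matrix.of fun i j => ∫ τ in tr..te, ω τ i * ω τ j) - α • (1 : Matrix ι ι ℝ)).PosSemidef

/-- The extended signals: `q̄' = e^{-σ(t - t₀)} φ q`, `φ̄' = e^{-σ(t - t₀)} φ φᵀ`, with zero
initial conditions. -/
structure IsExtension {n : ℕ} (σ t₀ : ℝ) (φ : ℝ → RegIdx n → ℝ) (q : ℝ → ℝ)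
    (qbar : ℝ → RegIdx n → ℝ) (φbar : ℝ → Matrix (RegIdx n) (RegIdx n) ℝ) : Prop where
  q_init : qbar t₀ = 0
  φ_init : φbar t₀ = 0
  q_rate : ∀ i, HasRateFrom t₀ (fun t => qbar t i)
    (fun t => Real.exp (-σ * (t - t₀)) * (φ t i * q t))
  φ_rate : ∀ i j, HasRateFrom t₀ (fun t => φbar t i j)
    (fun t => Real.exp (-σ * (t - t₀)) * (φ t i * φ t j))

/-- `Δ = k det φ̄`. -/
def delta {n : ℕ} (k : ℝ) (φbar : Matrix (RegIdx n) (RegIdx n) ℝ) : ℝ := k * φbar.det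

/-- `𝒴 = k 𝓛_ab 𝓛₀ adj(φ̄) q̄`, where `𝓛₀ = [I 0]`. -/
def calY {n nθ nΘ : ℕ} (sys : SystemClass n nθ nΘ) (k : ℝ)
    (φbar : Matrix (RegIdx n) (RegIdx n) ℝ) (qbar : RegIdx n → ℝ) : Fin nθ → ℝ :=
  k • (sys.Lab *ᵥ ((Matrix.fromCols 1 0 : Matrix (Fin n ⊕ Fin n) (RegIdx n) ℝ) *ᵥ
    (φbar.adjugate *ᵥ qbar)))

namespace KnownMaps

variable {n nθ nΘ : ℕ}

/-- `ℳ_θ`, from the values of `Δ` and `𝒴`. -/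
def Mθ (m : KnownMaps n nθ nΘ) (Δ : ℝ) (Y : Fin nθ → ℝ) : ℝ := (m.TG (m.ΞG.bar Δ *ᵥ Y)).det

/-- `𝒴_θ`, from the values of `Δ` and `𝒴`. -/
def Yθ (m : KnownMaps n nθ nΘ) (Δ : ℝ) (Y : Fin nθ → ℝ) : Fin nθ → ℝ :=
  (m.TG (m.ΞG.bar Δ *ᵥ Y)).adjugate *ᵥ m.TS (m.ΞS.bar Δ *ᵥ Y)

/-- `𝒴_ϑ = (𝒴_θ, ℳ_θ ψ_am(a_m))`. -/
def Yvartheta (m : KnownMaps n nθ nΘ) (am : ℝ) (Δ : ℝ) (Y : Fin nθ → ℝ) : Fin nθ ⊕ Fin n → ℝ :=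
  Sum.elim (m.Yθ Δ Y) (m.Mθ Δ Y • m.ψam am)

/-- `ℳ_AB`. -/
def MAB (m : KnownMaps n nθ nΘ) (Δ : ℝ) (Y : Fin nθ → ℝ) : ℝ := (m.PiΘ (m.Mθ Δ Y)).det

/-- `𝒴_AB`. -/
def YAB (m : KnownMaps n nθ nΘ) (Δ : ℝ) (Y : Fin nθ → ℝ) : Fin nΘ → ℝ :=
  (m.PiΘ (m.Mθ Δ Y)).adjugate *ᵥ m.TΘ (m.ΞΘ.bar (m.Mθ Δ Y) *ᵥ m.Yθ Δ Y)

/-- `ℳ_L`. -/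
def ML (m : KnownMaps n nθ nΘ) (Δ : ℝ) (Y : Fin nθ → ℝ) : ℝ :=
  (m.TP (m.ΞP.bar (m.Mθ Δ Y) *ᵥ m.Yθ Δ Y)).det

/-- `𝒴_L`. -/
def YL (m : KnownMaps n nθ nΘ) (am : ℝ) (Δ : ℝ) (Y : Fin nθ → ℝ) : Fin n → ℝ :=
  (m.TP (m.ΞP.bar (m.Mθ Δ Y) *ᵥ m.Yθ Δ Y)).adjugate *ᵥ
    m.TQ (m.ΞQ.bar (m.Mθ Δ Y) *ᵥ m.Yvartheta am Δ Y)

end KnownMaps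

/-! ### The adaptive observer -/

/-- The gain `γ_Θ`, with `ΦT = Φᵀ(x̂, u)`. -/
def gainΘ {n nΘ : ℕ} (γ₀ γ₁ ρ Δ MAB : ℝ) (ΦT : Matrix (Fin n) (Fin nΘ) ℝ) : ℝ :=
  if Δ < ρ then 0 else (γ₁ + γ₀ * lambdaMax (ΦTᵀ * ΦT)) / MAB ^ 2

/-- The gain `γ_L`, with `yt` the output error. -/
def gainL (γ₀ γ₁ ρ Δ ML yt : ℝ) : ℝ :=
  if Δ < ρ then 0 else (γ₁ + γ₀ * yt ^ 2) / ML ^ 2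

/-- `xh`, `Θh`, `Lh` solve the observer equation and the identification laws on `[t₀, ∞)` (with
arbitrary initial values), for the signals `Δ` and `Y`. -/
structure IsObserver {n nθ nΘ : ℕ} (sys : SystemClass n nθ nΘ) (m : KnownMaps n nθ nΘ)
    (am γ₀ γ₁ ρ t₀ : ℝ) (u y Δ : ℝ → ℝ) (Y : ℝ → Fin nθ → ℝ)
    (xh : ℝ → Fin n → ℝ) (Θh : ℝ → Fin nΘ → ℝ) (Lh : ℝ → Fin n → ℝ) : Prop where
  state : ∀ i, HasRateFrom t₀ (fun t => xh t i)
    (fun t => (sys.ΦT (xh t) (u t) *ᵥ Θh t - (sys.outC ⬝ᵥ xh t - y t) • Lh t) i)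
  lawΘ : ∀ i, HasRateFrom t₀ (fun t => Θh t i)
    (fun t => -gainΘ γ₀ γ₁ ρ (Δ t) (m.MAB (Δ t) (Y t)) (sys.ΦT (xh t) (u t)) *
      m.MAB (Δ t) (Y t) * (m.MAB (Δ t) (Y t) * Θh t i - m.YAB (Δ t) (Y t) i))
  lawL : ∀ i, HasRateFrom t₀ (fun t => Lh t i)
    (fun t => -gainL γ₀ γ₁ ρ (Δ t) (m.ML (Δ t) (Y t)) (sys.outC ⬝ᵥ xh t - y t) *
      m.ML (Δ t) (Y t) * (m.ML (Δ t) (Y t) * Lh t i - m.YL am (Δ t) (Y t) i))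

end AdaptiveObserver

end

noncomputable section

namespace AdaptiveObserver

open MeasureTheory Set

/-! ### Linear algebra of positive semidefinite matrices -/

/-! The filters turn the unknown parameters into exact scalar regressions. The error `ξ - z - Ω ψa -
P ψb` solves the homogeneous equation with matrix `A_K`, so `q = φᵀ η` with constant `η = (ψa, ψb,
-ξ(t₀))` (`qSignal_eq`). Integrating gives `q̄ = φ̄ η`, and the adjugate gives `𝒴 = Δ ψ_ab`
(`IsExtension.calY_eq`). Heterogeneity carries a relation "signal = scalar times unknown" through
each nonlinear map, whence `𝒴_θ = ℳ_θ θ`, `𝒴_AB = ℳ_AB Θ_AB`, `𝒴_L = ℳ_L L`, with nonzero scalars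
wherever `Δ > 0`.

Since `φ̄` increases in the Loewner order, `Δ` is nondecreasing. Once it reaches `ρ` at some `t₁`,
the gains stay switched on, and each entry `v` of the two gain errors solves `v' = -(γ₁ + γ₀ λ) v`,
with `λ = λ_max(ΦΦᵀ)` or `λ = ỹ²`. The weighted energy `e^{2γ₁(t - t₁)} v²` then gives decay at rate
`γ₁` and also a finite value of `∫ e^{2γ₁(t - t₁)} λ v²` (`integral_damping_le`).

This integral is what closes the argument. The state error obeys `w' = (A - L 𝒞ᵀ) w + Φᵀ Θ̃ - ỹ L̃`,
and the square of its forcing is controlled by exactly these `λ v²`, so no prior bound on `x̂` is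
needed. Young's inequality makes `e^{κ(t - t₁)}` times the forcing integrable for `κ < γ₁`. The
exponential of `A - L 𝒞ᵀ` decays at every rate `κ < a_m`, and variation of constants concludes
(`exists_abs_le_exp_of_forced`). -/

theorem one_le_det_of_posSemidef_sub_one {ι : Type*} [Fintype ι] [DecidableEq ι]
    {M : Matrix ι ι ℝ} (h : (M - 1).PosSemidef) : 1 ≤ M.det := by
  have hM : M.IsHermitian := by
    have := h.isHermitian.add (Matrix.isHermitian_one (n := ι) (α := ℝ))
    simpa using this
  rw [hM.det_eq_prod_eigenvalues]
  have key : ∀ i, 1 ≤ hM.eigenvalues i := fun i => by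
    have h1 := hM.eigenvalues_mem_spectrum_real i
    have h2 : hM.eigenvalues i - 1 ∈ spectrum ℝ (M - 1) := by
      have := spectrum.sub_singleton_eq (R := ℝ) M 1
      rw [map_one] at this
      rw [← this]
      exact Set.sub_mem_sub h1 rfl
    have := (Matrix.posSemidef_iff_isHermitian_and_spectrum_nonneg.1 h).2 h2
    simpa using this
  simpa using Finset.prod_le_prod (s := Finset.univ) (fun _ _ => zero_le_one' ℝ)
    (fun i _ => key i)

/-- If `M` is singular the claim is nonnegativity of `det N`. Otherwise `M = Rᴴ R` with `R`
invertible, and congruence by `R⁻¹` reduces to the case `M = 1`. -/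
theorem det_le_det_of_posSemidef_sub {ι : Type*} [Fintype ι] [DecidableEq ι]
    {M N : Matrix ι ι ℝ} (hM : M.PosSemidef) (hMN : (N - M).PosSemidef) : M.det ≤ N.det := by
  have hN : N.PosSemidef := by simpa using hMN.add hM
  by_cases h0 : M.det = 0
  · rw [h0]; exact hN.det_nonneg
  have hMd : M.PosDef := hM.posDef_iff_det_ne_zero.2 h0
  obtain ⟨R, hR, hRM⟩ : ∃ R : Matrix ι ι ℝ, IsUnit R ∧ M = Rᴴ * R := by
    open scoped MatrixOrder in
    obtain ⟨R, hR⟩ := CStarAlgebra.nonneg_iff_eq_star_mul_self.1 hM.nonneg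
    refine ⟨R, ?_, hR⟩
    rw [Matrix.isUnit_iff_isUnit_det, isUnit_iff_ne_zero]
    intro h
    apply h0
    rw [hR, Matrix.det_mul, h, mul_zero]
  have hRd : IsUnit R.det := (Matrix.isUnit_iff_isUnit_det R).1 hR
  have h1 : 1 ≤ ((R⁻¹)ᴴ * N * R⁻¹).det := by
    apply one_le_det_of_posSemidef_sub_one
    have h2 : (R⁻¹)ᴴ * N * R⁻¹ - 1 = (R⁻¹)ᴴ * (N - M) * R⁻¹ := by
      have h3 : (R⁻¹)ᴴ * M * R⁻¹ = 1 := by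
        rw [hRM, ← mul_assoc, ← Matrix.conjTranspose_mul, Matrix.mul_nonsing_inv R hRd,
          Matrix.conjTranspose_one, one_mul, Matrix.mul_nonsing_inv R hRd]
      rw [mul_sub, sub_mul, h3]
    rw [h2]
    exact hMN.conjTranspose_mul_mul_same _
  have hdet : M.det = R.det * R.det := by
    rw [hRM, Matrix.det_mul, Matrix.det_conjTranspose]; simp
  have hN' : N.det = M.det * ((R⁻¹)ᴴ * N * R⁻¹).det := by
    have h4 : R.det * R⁻¹.det = 1 := by
      rw [← Matrix.det_mul, Matrix.mul_nonsing_inv R hRd, Matrix.det_one]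
    rw [Matrix.det_mul, Matrix.det_mul, Matrix.det_conjTranspose, hdet]
    simp only [star_trivial]
    -- With `p = det R · det R⁻¹`, this is `1 - p² = -(1 + p)(p - 1)`.
    linear_combination (-(N.det) * (1 + R.det * R⁻¹.det)) * h4
  rw [hN']
  exact le_mul_of_one_le_right hM.det_nonneg h1

theorem det_ne_zero_of_rank_eq {n : ℕ} {M : Matrix (Fin n) (Fin n) ℝ} (h : M.rank = n) :
    M.det ≠ 0 := by
  rw [← isUnit_iff_ne_zero, ← Matrix.isUnit_iff_isUnit_det, ← Matrix.mulVec_surjective_iff_isUnit]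
  rw [Matrix.rank] at h
  have : LinearMap.range M.mulVecLin = ⊤ := by
    apply Submodule.eq_top_of_finrank_eq
    simpa using h
  exact LinearMap.range_eq_top.1 this

theorem le_lambdaMax {m : ℕ} {M : Matrix (Fin m) (Fin m) ℝ} {s : ℝ} (hs : s ∈ spectrum ℝ M) :
    s ≤ lambdaMax M :=
  le_csSup M.finite_real_spectrum.bddAbove hs

theorem lambdaMax_nonneg {m : ℕ} {M : Matrix (Fin m) (Fin m) ℝ} (hM : M.PosSemidef) :
    0 ≤ lambdaMax M :=
  Real.sSup_nonneg fun _ hs => (Matrix.posSemidef_iff_isHermitian_and_spectrum_nonneg.1 hM).2 hs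

theorem dotProduct_mulVec_le_lambdaMax {m : ℕ} {M : Matrix (Fin m) (Fin m) ℝ}
    (hM : M.IsHermitian) (v : Fin m → ℝ) : v ⬝ᵥ (M *ᵥ v) ≤ lambdaMax M * (v ⬝ᵥ v) := by
  have h : (algebraMap ℝ (Matrix (Fin m) (Fin m) ℝ) (lambdaMax M) - M).PosSemidef := by
    rw [Matrix.posSemidef_iff_isHermitian_and_spectrum_nonneg]
    refine ⟨?_, ?_⟩
    · refine Matrix.IsHermitian.sub ?_ hM
      rw [Matrix.algebraMap_eq_diagonal]
      exact Matrix.isHermitian_diagonal _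
    · rw [← spectrum.singleton_sub_eq]
      rintro _ ⟨_, rfl, s, hs, rfl⟩
      exact sub_nonneg.2 (le_lambdaMax hs)
  have := h.dotProduct_mulVec_nonneg v
  rw [Matrix.sub_mulVec, dotProduct_sub, Algebra.algebraMap_eq_smul_one, Matrix.smul_mulVec,
    Matrix.one_mulVec, dotProduct_smul] at this
  simpa using this

theorem lambdaMax_gram_nonneg {m n : ℕ} (M : Matrix (Fin n) (Fin m) ℝ) :
    0 ≤ lambdaMax (Mᵀ * M) :=
  lambdaMax_nonneg (by simpa using Matrix.posSemidef_conjTranspose_mul_self M)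

theorem sq_mulVec_le_lambdaMax {m n : ℕ} (M : Matrix (Fin n) (Fin m) ℝ) (v : Fin m → ℝ)
    (i : Fin n) : (M *ᵥ v) i ^ 2 ≤ lambdaMax (Mᵀ * M) * ∑ j, v j ^ 2 := by
  have h := dotProduct_mulVec_le_lambdaMax (M := Mᵀ * M)
    (by simpa using Matrix.isHermitian_conjTranspose_mul_self M) v
  rw [← Matrix.mulVec_mulVec, Matrix.dotProduct_mulVec, Matrix.vecMul_transpose] at h
  calc (M *ᵥ v) i ^ 2 ≤ ∑ i, (M *ᵥ v) i ^ 2 :=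
        Finset.single_le_sum (f := fun i => (M *ᵥ v) i ^ 2) (fun _ _ => sq_nonneg _)
          (Finset.mem_univ i)
    _ = (M *ᵥ v) ⬝ᵥ (M *ᵥ v) := by simp [dotProduct, sq]
    _ ≤ _ := h
    _ = _ := by simp [dotProduct, sq]

/-! ### Heterogeneous mappings -/

theorem PowerMatrix.bar_mulVec_smul {δ ι : Type} [Fintype ι] (Ξ : PowerMatrix δ ι) (ω : ℝ)
    (x : ι → ℝ) : Ξ.bar ω *ᵥ (ω • x) = Ξ.full ω *ᵥ x := by
  rw [Ξ.full_eq_smul_bar, Matrix.mulVec_smul, Matrix.smul_mulVec]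

/-- Only the product `ω x` is available as a signal. The factor `ω` taken out of `Ξ` is the one
already contained in that signal, so `T` can be evaluated without dividing. -/
theorem IsHeterogeneous.apply_bar {ι δ : Type} [Fintype ι] {r s : ℕ}
    {F : (ι → ℝ) → Matrix (Fin r) (Fin s) ℝ} {Pi : ℝ → Matrix (Fin r) (Fin r) ℝ}
    {Ξ : PowerMatrix δ ι} {T : (δ → ℝ) → Matrix (Fin r) (Fin s) ℝ} {ℓ : ℕ}
    (h : IsHeterogeneous F Pi Ξ T ℓ) (ω : ℝ) (x : ι → ℝ) :
    T (Ξ.bar ω *ᵥ (ω • x)) = Pi ω * F x := by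
  rw [Ξ.bar_mulVec_smul, h.2.1]

theorem IsHeterogeneousVec.apply_bar {ι δ : Type} [Fintype ι] {r : ℕ}
    {F : (ι → ℝ) → Fin r → ℝ} {Pi : ℝ → Matrix (Fin r) (Fin r) ℝ}
    {Ξ : PowerMatrix δ ι} {T : (δ → ℝ) → Fin r → ℝ} {ℓ : ℕ}
    (h : IsHeterogeneousVec F Pi Ξ T ℓ) (ω : ℝ) (x : ι → ℝ) :
    T (Ξ.bar ω *ᵥ (ω • x)) = Pi ω *ᵥ F x := by
  have := IsHeterogeneous.apply_bar h ω x
  ext i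
  have h1 := congrFun (congrFun this i) 0
  simpa [Matrix.mul_apply, Matrix.mulVec, dotProduct] using h1

theorem IsHeterogeneous.det_pos {ι δ : Type} [Fintype ι] {r s : ℕ}
    {F : (ι → ℝ) → Matrix (Fin r) (Fin s) ℝ} {Pi : ℝ → Matrix (Fin r) (Fin r) ℝ}
    {Ξ : PowerMatrix δ ι} {T : (δ → ℝ) → Matrix (Fin r) (Fin s) ℝ} {ℓ : ℕ}
    (h : IsHeterogeneous F Pi Ξ T ℓ) {ω : ℝ} (hω : 0 < ω) : 0 < (Pi ω).det :=
  (pow_pos hω ℓ).trans_le (h.2.2 ω)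

/-- Both signs of `ω` matter: it will be `ℳ_θ`, which contains `det G` and may be negative, where
the power bound on `det Pi` alone is not enough. -/
theorem IsHeterogeneous.det_ne_zero {ι δ : Type} [Fintype ι] {r s : ℕ}
    {F : (ι → ℝ) → Matrix (Fin r) (Fin s) ℝ} {Pi : ℝ → Matrix (Fin r) (Fin r) ℝ}
    {Ξ : PowerMatrix δ ι} {T : (δ → ℝ) → Matrix (Fin r) (Fin s) ℝ} {ℓ : ℕ}
    (h : IsHeterogeneous F Pi Ξ T ℓ) (hneg : ∀ ω < 0, (Pi ω).det ≠ 0) {ω : ℝ} (hω : ω ≠ 0) :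
    (Pi ω).det ≠ 0 :=
  hω.lt_or_gt.elim (hneg ω) fun hpos => (h.det_pos hpos).ne'

/-! ### The regression equations for the parameters -/

section Regressions

variable {n nθ nΘ : ℕ} {sys : SystemClass n nθ nΘ} {m : KnownMaps n nθ nΘ} {θ : Fin nθ → ℝ}
  {Δ am : ℝ} {Y : Fin nθ → ℝ} {L : Fin n → ℝ}

theorem Identifiable.Mθ_ne_zero (h : Identifiable sys m θ) (hΔ : 0 < Δ)
    (hY : Y = Δ • sys.ψab θ) : m.Mθ Δ Y ≠ 0 := by
  rw [KnownMaps.Mθ, hY, h.hetG.apply_bar, Matrix.det_mul]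
  exact mul_ne_zero (h.hetG.det_pos hΔ).ne' (det_ne_zero_of_rank_eq h.rankG)

/-- `G` and `S` share the factor `Piθ`, so both sides of `S = G θ` are multiplied by the same
matrix; the adjugate of `Piθ G` then leaves its determinant times `θ`. -/
theorem Identifiable.Yθ_eq (h : Identifiable sys m θ) (hY : Y = Δ • sys.ψab θ) :
    m.Yθ Δ Y = m.Mθ Δ Y • θ := by
  rw [KnownMaps.Mθ, KnownMaps.Yθ, hY, h.hetG.apply_bar, h.hetS.apply_bar, h.eq,
    Matrix.mulVec_mulVec, Matrix.mulVec_mulVec, mul_assoc, Matrix.adjugate_mul, Matrix.smul_mulVec,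
    Matrix.one_mulVec]

theorem ThetaHeterogeneous.MAB_ne_zero (hΘ : ThetaHeterogeneous sys m)
    (h : Identifiable sys m θ) (hΔ : 0 < Δ) (hY : Y = Δ • sys.ψab θ) : m.MAB Δ Y ≠ 0 :=
  IsHeterogeneous.det_ne_zero hΘ.het hΘ.nonsing (h.Mθ_ne_zero hΔ hY)

theorem ThetaHeterogeneous.YAB_eq (hΘ : ThetaHeterogeneous sys m) (h : Identifiable sys m θ)
    (hY : Y = Δ • sys.ψab θ) : m.YAB Δ Y = m.MAB Δ Y • sys.ΘAB θ := by
  rw [KnownMaps.YAB, KnownMaps.MAB, h.Yθ_eq hY, hΘ.het.apply_bar, Matrix.mulVec_mulVec,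
    Matrix.adjugate_mul, Matrix.smul_mulVec, Matrix.one_mulVec]

theorem LuenbergerGain.ML_ne_zero (hL : LuenbergerGain sys m am θ L) (h : Identifiable sys m θ)
    (hΔ : 0 < Δ) (hY : Y = Δ • sys.ψab θ) : m.ML Δ Y ≠ 0 := by
  rw [KnownMaps.ML, h.Yθ_eq hY, hL.hetP.apply_bar, Matrix.det_mul]
  exact mul_ne_zero (hL.hetP.det_ne_zero hL.nonsing (h.Mθ_ne_zero hΔ hY))
    (det_ne_zero_of_rank_eq hL.rankP)

theorem LuenbergerGain.YL_eq (hL : LuenbergerGain sys m am θ L) (h : Identifiable sys m θ)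
    (hY : Y = Δ • sys.ψab θ) : m.YL am Δ Y = m.ML Δ Y • L := by
  -- The known block was multiplied by `ℳ_θ` so that the whole stacked vector carries one common
  -- scalar.
  have hv : m.Yvartheta am Δ Y = m.Mθ Δ Y • Sum.elim θ (m.ψam am) := by
    rw [KnownMaps.Yvartheta, h.Yθ_eq hY]
    ext (i | i) <;> rfl
  rw [KnownMaps.YL, KnownMaps.ML, hv, h.Yθ_eq hY, hL.hetP.apply_bar, hL.hetQ.apply_bar, hL.eq,
    Matrix.mulVec_mulVec, Matrix.mulVec_mulVec, mul_assoc, Matrix.adjugate_mul, Matrix.smul_mulVec,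
    Matrix.one_mulVec]

end Regressions

/-! ### Calculus of Carathéodory solutions -/

theorem intervalIntegrable_finsetSum {ι : Type*} (s : Finset ι) {F : ι → ℝ → ℝ} {a b : ℝ}
    (h : ∀ i ∈ s, IntervalIntegrable (F i) volume a b) :
    IntervalIntegrable (fun t => ∑ i ∈ s, F i t) volume a b := by
  rw [← Finset.sum_fn]
  exact IntervalIntegrable.sum s h

namespace HasRateFrom

variable {t₀ t₁ : ℝ} {f g f' g' : ℝ → ℝ}

theorem intervalIntegrable (h : HasRateFrom t₀ f f') {a b : ℝ} (ha : t₀ ≤ a) (hb : t₀ ≤ b) :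
    IntervalIntegrable f' volume a b :=
  (h a ha).1.symm.trans (h b hb).1

theorem sub_eq (h : HasRateFrom t₀ f f') {a b : ℝ} (ha : t₀ ≤ a) (hb : t₀ ≤ b) :
    f b - f a = ∫ τ in a..b, f' τ := by
  rw [(h a ha).2, (h b hb).2, ← intervalIntegral.integral_add_adjacent_intervals (h a ha).1
    (h.intervalIntegrable ha hb)]
  ring

theorem mono (h : HasRateFrom t₀ f f') (ht : t₀ ≤ t₁) : HasRateFrom t₁ f f' := fun t h1 =>
  ⟨h.intervalIntegrable ht (ht.trans h1), by rw [← h.sub_eq ht (ht.trans h1)]; ring⟩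

theorem congr (h : HasRateFrom t₀ f f') (hf : ∀ t, t₀ ≤ t → f t = g t)
    (hf' : ∀ t, t₀ ≤ t → f' t = g' t) : HasRateFrom t₀ g g' := fun t ht => by
  have key : ∀ s ∈ uIoc t₀ t, f' s = g' s := fun s hs => by
    rw [uIoc_of_le ht] at hs
    exact hf' s hs.1.le
  refine ⟨(h t ht).1.congr fun s hs => key s hs, ?_⟩
  rw [← hf t ht, ← hf t₀ le_rfl, (h t ht).2,
    intervalIntegral.integral_congr_ae (Filter.Eventually.of_forall key)]

theorem continuousOn (h : HasRateFrom t₀ f f') (t : ℝ) : ContinuousOn f (Icc t₀ t) := by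
  rcases lt_or_ge t t₀ with ht | ht
  · rw [Icc_eq_empty ht.not_ge]; exact continuousOn_empty f
  have h1 : ContinuousOn (fun s => f t₀ + ∫ τ in t₀..s, f' τ) (uIcc t₀ t) :=
    continuousOn_const.add (intervalIntegral.continuousOn_primitive_interval'
      (h t ht).1 left_mem_uIcc)
  rw [uIcc_of_le ht] at h1
  exact h1.congr fun s hs => (h s hs.1).2

theorem of_hasDerivAt (h : ∀ t, HasDerivAt f (f' t) t) (hc : Continuous f') :
    HasRateFrom t₀ f f' := fun t _ => by
  refine ⟨hc.intervalIntegrable _ _, ?_⟩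
  rw [intervalIntegral.integral_eq_sub_of_hasDerivAt (fun s _ => h s) (hc.intervalIntegrable _ _)]
  ring

theorem const (c : ℝ) : HasRateFrom t₀ (fun _ => c) (fun _ => 0) :=
  of_hasDerivAt (fun t => hasDerivAt_const t c) continuous_const

theorem add (hf : HasRateFrom t₀ f f') (hg : HasRateFrom t₀ g g') :
    HasRateFrom t₀ (fun t => f t + g t) (fun t => f' t + g' t) := fun t ht => by
  refine ⟨(hf t ht).1.add (hg t ht).1, ?_⟩
  rw [intervalIntegral.integral_add (hf t ht).1 (hg t ht).1]
  linear_combination (hf t ht).2 + (hg t ht).2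

theorem const_mul (hf : HasRateFrom t₀ f f') (c : ℝ) :
    HasRateFrom t₀ (fun t => c * f t) (fun t => c * f' t) := fun t ht => by
  refine ⟨(hf t ht).1.const_mul c, ?_⟩
  rw [intervalIntegral.integral_const_mul]
  linear_combination c * (hf t ht).2

theorem sub (hf : HasRateFrom t₀ f f') (hg : HasRateFrom t₀ g g') :
    HasRateFrom t₀ (fun t => f t - g t) (fun t => f' t - g' t) :=
  (hf.add (hg.const_mul (-1))).congr (fun _ _ => by ring) (fun _ _ => by ring)

theorem sum {ι : Type*} (s : Finset ι) {F F' : ι → ℝ → ℝ}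
    (h : ∀ i ∈ s, HasRateFrom t₀ (F i) (F' i)) :
    HasRateFrom t₀ (fun t => ∑ i ∈ s, F i t) (fun t => ∑ i ∈ s, F' i t) := by
  classical
  induction s using Finset.induction_on with
  | empty => simpa using const (t₀ := t₀) 0
  | insert a s ha ih =>
    simp only [Finset.sum_insert ha]
    exact (h a (Finset.mem_insert_self a s)).add
      (ih fun i hi => h i (Finset.mem_insert_of_mem hi))

/-- The function `f` is unconstrained before `t₀`; its primitive representative is absolutely
continuous with derivative `f'` almost everywhere, which is what integration by parts needs in the
product rule. -/
theorem exists_absolutelyContinuous (hf : HasRateFrom t₀ f f') {t : ℝ} (ht : t₀ ≤ t) :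
    ∃ F : ℝ → ℝ, AbsolutelyContinuousOnInterval F t₀ t ∧ (∀ s ∈ Icc t₀ t, F s = f s) ∧
      ∀ᵐ s, s ∈ uIcc t₀ t → deriv F s = f' s := by
  have hint := (hf t ht).1
  refine ⟨fun s => f t₀ + ∫ τ in t₀..s, f' τ, ?_, fun s hs => ((hf s hs.1).2).symm, ?_⟩
  · exact (contDiffOn_const (n := 1)).absolutelyContinuousOnInterval.add
      (hint.absolutelyContinuousOnInterval_intervalIntegral left_mem_uIcc)
  · filter_upwards [hint.ae_hasDerivAt_integral] with s hs hst
    exact ((hs hst t₀ left_mem_uIcc).const_add (f t₀)).deriv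

theorem mul (hf : HasRateFrom t₀ f f') (hg : HasRateFrom t₀ g g') :
    HasRateFrom t₀ (fun t => f t * g t) (fun t => f' t * g t + f t * g' t) := fun t ht => by
  have hfc : ContinuousOn f (uIcc t₀ t) := by rw [uIcc_of_le ht]; exact hf.continuousOn t
  have hgc : ContinuousOn g (uIcc t₀ t) := by rw [uIcc_of_le ht]; exact hg.continuousOn t
  refine ⟨((hf t ht).1.mul_continuousOn hgc).add ((hg t ht).1.continuousOn_mul hfc), ?_⟩
  obtain ⟨F, hF, hFf, hF'⟩ := hf.exists_absolutelyContinuous ht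
  obtain ⟨G, hG, hGg, hG'⟩ := hg.exists_absolutelyContinuous ht
  have h1 := hF.integral_deriv_mul_eq_sub hG
  have h2 : ∫ s in t₀..t, deriv F s * G s + F s * deriv G s
      = ∫ s in t₀..t, f' s * g s + f s * g' s := by
    apply intervalIntegral.integral_congr_ae
    filter_upwards [hF', hG'] with s hs1 hs2 hs
    have hs' := uIoc_subset_uIcc hs
    have hs'' := hs'
    rw [uIcc_of_le ht] at hs''
    rw [hs1 hs', hs2 hs', hFf s hs'', hGg s hs'']
  rw [h2, hFf t ⟨ht, le_rfl⟩, hFf t₀ ⟨le_rfl, ht⟩, hGg t ⟨ht, le_rfl⟩, hGg t₀ ⟨le_rfl, ht⟩] at h1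
  linarith

end HasRateFrom

/-! ### Linear equations and the matrix exponential -/

section MatrixExp

attribute [local instance] Matrix.linftyOpNormedRing Matrix.linftyOpNormedAlgebra

theorem hasDerivAt_exp_smul_apply {n : ℕ} (M : Matrix (Fin n) (Fin n) ℝ) (t : ℝ) (i j : Fin n) :
    HasDerivAt (fun t : ℝ => NormedSpace.exp (t • M) i j)
      ((NormedSpace.exp (t • M) * M) i j) t := by
  have h := hasDerivAt_exp_smul_const (𝕂 := ℝ) M t
  have h1 := hasDerivAt_pi.1 h i
  exact hasDerivAt_pi.1 h1 j

theorem exp_smul_eq_sum_of_pow_eq_zero {n : ℕ} {N : Matrix (Fin n) (Fin n) ℝ} {d : ℕ}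
    (hN : N ^ d = 0) (t : ℝ) :
    NormedSpace.exp (t • N) = ∑ k ∈ Finset.range d, ((k.factorial : ℝ)⁻¹ * t ^ k) • N ^ k := by
  rw [NormedSpace.exp_eq_tsum ℝ]
  beta_reduce
  rw [tsum_eq_sum (s := Finset.range d)]
  · refine Finset.sum_congr rfl fun k _ => ?_
    rw [smul_pow, smul_smul]
  · intro k hk
    have hk' : d ≤ k := by simpa using hk
    rw [smul_pow, pow_eq_zero_of_le hk' hN, smul_zero, smul_zero]

theorem exp_smul_eq_of_add {n : ℕ} (M : Matrix (Fin n) (Fin n) ℝ) (a t : ℝ) :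
    NormedSpace.exp (t • M) =
      Real.exp (-a * t) • NormedSpace.exp (t • (M + a • (1 : Matrix (Fin n) (Fin n) ℝ))) := by
  have h : t • M = (-a * t) • (1 : Matrix (Fin n) (Fin n) ℝ)
      + t • (M + a • (1 : Matrix (Fin n) (Fin n) ℝ)) := by
    rw [smul_add, smul_smul, add_comm, add_assoc, ← add_smul]
    simp [mul_comm]
  have hc : Commute ((-a * t) • (1 : Matrix (Fin n) (Fin n) ℝ))
      (t • (M + a • (1 : Matrix (Fin n) (Fin n) ℝ))) :=
    (Commute.one_left _).smul_left _
  conv_lhs => rw [h]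
  rw [Matrix.exp_add_of_commute _ _ hc]
  have h1 : NormedSpace.exp ((-a * t) • (1 : Matrix (Fin n) (Fin n) ℝ))
      = Real.exp (-a * t) • (1 : Matrix (Fin n) (Fin n) ℝ) := by
    rw [← Matrix.diagonal_one, ← Matrix.diagonal_smul, Matrix.exp_diagonal,
      ← Matrix.diagonal_smul]
    congr 1
    ext i
    simp [Pi.coe_exp, Real.exp_eq_exp_ℝ]
  rw [h1, Matrix.smul_mul, one_mul]

end MatrixExp

theorem continuous_exp_smul_apply {n : ℕ} (M : Matrix (Fin n) (Fin n) ℝ) (i j : Fin n) :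
    Continuous fun t : ℝ => NormedSpace.exp (t • M) i j :=
  continuous_iff_continuousAt.2 fun t => (hasDerivAt_exp_smul_apply M t i j).continuousAt

theorem add_smul_one_pow_eq_zero {n : ℕ} {M : Matrix (Fin n) (Fin n) ℝ} {a : ℝ}
    (h : M.charpoly = (Polynomial.X + Polynomial.C a) ^ n) :
    (M + a • (1 : Matrix (Fin n) (Fin n) ℝ)) ^ n = 0 := by
  have := Matrix.aeval_self_charpoly M
  rw [h] at this
  simpa [Algebra.algebraMap_eq_smul_one] using this

/-- By Cayley–Hamilton `M + a` is nilpotent, so the exponential is `e^{-a t}` times a polynomial in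
`t`, and `e^{(a - b) t}` absorbs the polynomial. -/
theorem exists_abs_exp_smul_apply_le {n : ℕ} {M : Matrix (Fin n) (Fin n) ℝ} {a b : ℝ}
    (h : M.charpoly = (Polynomial.X + Polynomial.C a) ^ n) (hb : b < a) :
    ∃ C : ℝ, 0 ≤ C ∧ ∀ t, 0 ≤ t → ∀ i j, |NormedSpace.exp (t • M) i j| ≤ C * Real.exp (-b * t) := by
  set N := M + a • (1 : Matrix (Fin n) (Fin n) ℝ) with hNdef
  have hN : N ^ n = 0 := add_smul_one_pow_eq_zero h
  have hab : 0 < a - b := sub_pos.2 hb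
  refine ⟨∑ k ∈ Finset.range n, ((a - b) ^ k)⁻¹ * ∑ i, ∑ j, |(N ^ k) i j|, by positivity, ?_⟩
  intro t ht i j
  rw [exp_smul_eq_of_add M a t, exp_smul_eq_sum_of_pow_eq_zero hN, Matrix.smul_apply,
    Matrix.sum_apply, smul_eq_mul, abs_mul, abs_of_pos (Real.exp_pos _)]
  have h1 : |∑ k ∈ Finset.range n, (((k.factorial : ℝ)⁻¹ * t ^ k) • N ^ k) i j| ≤
      (∑ k ∈ Finset.range n, ((a - b) ^ k)⁻¹ * ∑ i, ∑ j, |(N ^ k) i j|) *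
        Real.exp ((a - b) * t) := by
    rw [Finset.sum_mul]
    refine (Finset.abs_sum_le_sum_abs _ _).trans (Finset.sum_le_sum fun k _ => ?_)
    rw [Matrix.smul_apply, smul_eq_mul, abs_mul, abs_of_nonneg (by positivity)]
    -- This is `s ^ k / k! ≤ e^s` at `s = (a - b) t`.
    have h2 : (k.factorial : ℝ)⁻¹ * t ^ k ≤ ((a - b) ^ k)⁻¹ * Real.exp ((a - b) * t) := by
      have := Real.pow_div_factorial_le_exp ((a - b) * t) (by positivity) k
      rw [mul_pow] at this
      have hpos : 0 < (a - b) ^ k := pow_pos hab k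
      rw [← mul_le_mul_iff_right₀ hpos, mul_inv_cancel_left₀ hpos.ne']
      calc _ = (a - b) ^ k * t ^ k / k.factorial := by ring
        _ ≤ _ := this
    have h3 : |(N ^ k) i j| ≤ ∑ i, ∑ j, |(N ^ k) i j| :=
      (Finset.single_le_sum (f := fun j => |(N ^ k) i j|) (fun _ _ => abs_nonneg _)
        (Finset.mem_univ j)).trans
      (Finset.single_le_sum (f := fun i => ∑ j, |(N ^ k) i j|)
        (fun _ _ => Finset.sum_nonneg fun _ _ => abs_nonneg _) (Finset.mem_univ i))
    calc _ ≤ (((a - b) ^ k)⁻¹ * Real.exp ((a - b) * t)) * ∑ i, ∑ j, |(N ^ k) i j| :=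
          mul_le_mul h2 h3 (abs_nonneg _) (by positivity)
      _ = _ := by ring
  calc _ ≤ Real.exp (-a * t) * _ := mul_le_mul_of_nonneg_left h1 (Real.exp_pos _).le
    _ = _ := by
      rw [mul_left_comm, ← Real.exp_add]
      ring_nf

/-- For fixed `T`, differentiate `e^{(T - s) M} w(s)` in `s`: the terms containing `M` cancel and
only the forcing remains. -/
theorem variation_of_constants {n : ℕ} {M : Matrix (Fin n) (Fin n) ℝ} {t₀ : ℝ}
    {w f : ℝ → Fin n → ℝ}
    (h : ∀ i, HasRateFrom t₀ (fun t => w t i) (fun t => (M *ᵥ w t + f t) i)) {T : ℝ}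
    (hT : t₀ ≤ T) (i : Fin n) :
    w T i = (NormedSpace.exp ((T - t₀) • M) *ᵥ w t₀) i +
        ∫ s in t₀..T, (NormedSpace.exp ((T - s) • M) *ᵥ f s) i := by
  have hX : ∀ j, HasRateFrom t₀ (fun s => NormedSpace.exp ((T - s) • M) i j)
      (fun s => -(NormedSpace.exp ((T - s) • M) * M) i j) := fun j => by
    apply HasRateFrom.of_hasDerivAt
    · intro s
      have h1 := (hasDerivAt_exp_smul_apply M (T - s) i j).comp s
        ((hasDerivAt_id s).const_sub T)
      rw [mul_neg_one] at h1
      exact h1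
    · simp only [Matrix.mul_apply]
      exact (continuous_finsetSum _ fun k _ => ((continuous_exp_smul_apply M i k).comp
        (continuous_const.sub continuous_id)).mul continuous_const).neg
  have h1 := HasRateFrom.sum Finset.univ fun j _ => (hX j).mul (h j)
  have h2 := h1.congr (g := fun s => (NormedSpace.exp ((T - s) • M) *ᵥ w s) i)
    (g' := fun s => (NormedSpace.exp ((T - s) • M) *ᵥ f s) i) (fun _ _ => rfl) (fun s _ => by
      have h3 : ∑ j, (NormedSpace.exp ((T - s) • M) * M) i j * w s j =
          ∑ j, NormedSpace.exp ((T - s) • M) i j * (M *ᵥ w s) j := by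
        change ((NormedSpace.exp ((T - s) • M) * M) *ᵥ w s) i =
          (NormedSpace.exp ((T - s) • M) *ᵥ (M *ᵥ w s)) i
        rw [Matrix.mulVec_mulVec]
      simp only [Pi.add_apply, mul_add, neg_mul, Finset.sum_add_distrib, Finset.sum_neg_distrib]
      rw [h3, neg_add_cancel_left]
      rfl)
  have h3 := (h2 T hT).2
  simpa using h3

/-- A solution of `w' = M w + f` decays at rate `κ` when all eigenvalues of `M` are `-a < -κ` and
`e^{κ t} f` is integrable. -/
theorem exists_abs_le_exp_of_forced {n : ℕ} {M : Matrix (Fin n) (Fin n) ℝ} {a κ t₀ H : ℝ}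
    {w f : ℝ → Fin n → ℝ} {g : ℝ → ℝ}
    (hM : M.charpoly = (Polynomial.X + Polynomial.C a) ^ n) (hκ : κ < a)
    (h : ∀ i, HasRateFrom t₀ (fun t => w t i) (fun t => (M *ᵥ w t + f t) i))
    (hf : ∀ t, t₀ ≤ t → ∀ i, Real.exp (κ * (t - t₀)) * |f t i| ≤ g t)
    (hg : ∀ t, t₀ ≤ t → IntervalIntegrable g volume t₀ t ∧ ∫ s in t₀..t, g s ≤ H) :
    ∃ c : ℝ, ∀ t, t₀ ≤ t → ∀ i, |w t i| ≤ c * Real.exp (-κ * (t - t₀)) := by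
  obtain ⟨C, hC, hexp⟩ := exists_abs_exp_smul_apply_le hM hκ
  refine ⟨C * ∑ j, |w t₀ j| + C * (n * H), fun T hT i => ?_⟩
  rw [variation_of_constants h hT i, add_mul]
  refine (abs_add_le _ _).trans (add_le_add ?_ ?_)
  · rw [Matrix.mulVec, dotProduct, Finset.mul_sum, Finset.sum_mul]
    refine (Finset.abs_sum_le_sum_abs _ _).trans (Finset.sum_le_sum fun j _ => ?_)
    rw [abs_mul, mul_right_comm]
    exact mul_le_mul_of_nonneg_right (hexp _ (sub_nonneg.2 hT) i j) (abs_nonneg _)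
  -- Splitting `e^{-κ(T - s)} = e^{-κ(T - t₀)} e^{κ(s - t₀)}` hands the second factor to the
  -- forcing. The factor `n` counts the components, each bounded by the same `g`.
  · have hbound : ∀ s ∈ Ioc t₀ T, ‖(NormedSpace.exp ((T - s) • M) *ᵥ f s) i‖ ≤
        C * Real.exp (-κ * (T - t₀)) * n * g s := fun s hs => by
      rw [Real.norm_eq_abs, Matrix.mulVec, dotProduct]
      refine (Finset.abs_sum_le_sum_abs _ _).trans ?_
      have : ∀ j ∈ Finset.univ, |NormedSpace.exp ((T - s) • M) i j * f s j| ≤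
          C * Real.exp (-κ * (T - t₀)) * g s := fun j _ => by
        rw [abs_mul]
        calc _ ≤ C * Real.exp (-κ * (T - s)) * |f s j| :=
              mul_le_mul_of_nonneg_right (hexp _ (sub_nonneg.2 hs.2) i j) (abs_nonneg _)
          _ = C * Real.exp (-κ * (T - t₀)) * (Real.exp (κ * (s - t₀)) * |f s j|) := by
              rw [show -κ * (T - s) = -κ * (T - t₀) + κ * (s - t₀) by ring, Real.exp_add]
              ring
          _ ≤ _ := mul_le_mul_of_nonneg_left (hf s hs.1.le j) (by positivity)
      refine (Finset.sum_le_sum this).trans ?_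
      rw [Finset.sum_const, Finset.card_univ, Fintype.card_fin, nsmul_eq_mul]
      linarith
    have h1 := intervalIntegral.norm_integral_le_of_norm_le hT
      (Filter.Eventually.of_forall hbound)
      ((hg T hT).1.const_mul (C * Real.exp (-κ * (T - t₀)) * n))
    rw [Real.norm_eq_abs, intervalIntegral.integral_const_mul] at h1
    refine h1.trans ?_
    calc _ ≤ C * Real.exp (-κ * (T - t₀)) * n * H :=
          mul_le_mul_of_nonneg_left (hg T hT).2 (by positivity)
      _ = _ := by ring

/-! ### Damped scalar equations -/

theorem hasRateFrom_exp_mul (b t₁ t₀ : ℝ) :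
    HasRateFrom t₀ (fun t => Real.exp (b * (t - t₁))) (fun t => b * Real.exp (b * (t - t₁))) := by
  apply HasRateFrom.of_hasDerivAt
  · intro t
    have h := ((((hasDerivAt_id t).sub_const t₁).const_mul b)).exp
    simpa [mul_comm] using h
  · fun_prop

/-- The energy balance of `v' = -(γ₁ + γ₀ λ) v`. -/
theorem hasRateFrom_exp_mul_sq_of_damped {t₁ γ₀ γ₁ : ℝ} {v lam : ℝ → ℝ}
    (h : HasRateFrom t₁ v (fun t => -(γ₁ + γ₀ * lam t) * v t)) :
    HasRateFrom t₁ (fun t => Real.exp (2 * γ₁ * (t - t₁)) * v t ^ 2)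
      (fun t => -(2 * γ₀) * (Real.exp (2 * γ₁ * (t - t₁)) * (lam t * v t ^ 2))) :=
  ((hasRateFrom_exp_mul (2 * γ₁) t₁ t₁).mul (h.mul h)).congr (fun t _ => by ring)
    (fun t _ => by ring)

/-- The energy balance says that the total dissipation cannot exceed the initial energy; the final
energy is nonnegative and is dropped. -/
theorem integral_damping_le {t₁ γ₀ γ₁ : ℝ} {v lam : ℝ → ℝ} (hγ₀ : 0 < γ₀)
    (h : HasRateFrom t₁ v (fun t => -(γ₁ + γ₀ * lam t) * v t)) {t : ℝ} (ht : t₁ ≤ t) :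
    IntervalIntegrable (fun s => Real.exp (2 * γ₁ * (s - t₁)) * (lam s * v s ^ 2)) volume t₁ t ∧
      ∫ s in t₁..t, Real.exp (2 * γ₁ * (s - t₁)) * (lam s * v s ^ 2) ≤
        v t₁ ^ 2 / (2 * γ₀) := by
  obtain ⟨h1, h2⟩ := hasRateFrom_exp_mul_sq_of_damped h t ht
  have h3 : -(2 * γ₀) ≠ 0 := by simpa using hγ₀.ne'
  constructor
  · refine (h1.const_mul (-(2 * γ₀))⁻¹).congr fun s _ => ?_
    exact inv_mul_cancel_left₀ h3 _
  · rw [intervalIntegral.integral_const_mul] at h2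
    simp only [sub_self, mul_zero, Real.exp_zero, one_mul] at h2
    have h4 : 0 ≤ Real.exp (2 * γ₁ * (t - t₁)) * v t ^ 2 := by positivity
    rw [le_div_iff₀ (by positivity)]
    linarith

theorem abs_le_of_damped {t₁ γ₀ γ₁ : ℝ} {v lam : ℝ → ℝ} (hγ₀ : 0 < γ₀)
    (hlam : ∀ t, 0 ≤ lam t) (h : HasRateFrom t₁ v (fun t => -(γ₁ + γ₀ * lam t) * v t)) {t : ℝ}
    (ht : t₁ ≤ t) : |v t| ≤ |v t₁| * Real.exp (-γ₁ * (t - t₁)) := by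
  have h2 := (hasRateFrom_exp_mul_sq_of_damped h t ht).2
  rw [intervalIntegral.integral_const_mul] at h2
  have h3 : 0 ≤ ∫ s in t₁..t, Real.exp (2 * γ₁ * (s - t₁)) * (lam s * v s ^ 2) :=
    intervalIntegral.integral_nonneg ht fun s _ =>
      mul_nonneg (Real.exp_pos _).le (mul_nonneg (hlam s) (sq_nonneg _))
  simp only [sub_self, mul_zero, Real.exp_zero, one_mul] at h2
  have h4 : Real.exp (2 * γ₁ * (t - t₁)) * v t ^ 2 ≤ v t₁ ^ 2 := by
    nlinarith
  have h5 : Real.exp (2 * γ₁ * (t - t₁)) = Real.exp (γ₁ * (t - t₁)) ^ 2 := by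
    rw [← Real.exp_nat_mul]; congr 1; push_cast; ring
  rw [h5, ← mul_pow] at h4
  have h6 := sq_le_sq.1 h4
  rw [abs_mul, abs_of_pos (Real.exp_pos _)] at h6
  rw [neg_mul, Real.exp_neg, ← div_eq_mul_inv, le_div_iff₀ (Real.exp_pos _), mul_comm]
  exact h6

theorem integral_exp_neg_le {a t₁ t : ℝ} (ha : 0 < a) :
    ∫ s in t₁..t, Real.exp (-a * (s - t₁)) ≤ 1 / a := by
  -- Starting at the minimum avoids assuming an order between `t₁` and `t`.
  have h : HasRateFrom (min t₁ t) (fun s => Real.exp (-a * (s - t₁))) _ :=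
    hasRateFrom_exp_mul (-a) t₁ _
  have h1 := h.sub_eq (min_le_left t₁ t) (min_le_right t₁ t)
  rw [intervalIntegral.integral_const_mul] at h1
  simp only [sub_self, mul_zero, Real.exp_zero] at h1
  have := Real.exp_pos (-a * (t - t₁))
  rw [le_div_iff₀ ha]
  linarith

/-- A bound that decays from `t₁` on extends to `[t₀, ∞)` for a solution of a differential
equation. -/
theorem HasRateFrom.exists_abs_le_exp {t₀ t₁ κ c : ℝ} {f f' : ℝ → ℝ} (hf : HasRateFrom t₀ f f')
    (h : ∀ t, t₁ ≤ t → |f t| ≤ c * Real.exp (-κ * (t - t₁))) :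
    ∃ c' : ℝ, 0 ≤ c' ∧ ∀ t, t₀ ≤ t → |f t| ≤ c' * Real.exp (-κ * (t - t₀)) := by
  have hcont : ContinuousOn (fun t => f t * Real.exp (κ * (t - t₀))) (Icc t₀ t₁) :=
    (hf.continuousOn t₁).mul (by fun_prop)
  obtain ⟨B, hB⟩ := isCompact_Icc.exists_bound_of_continuousOn hcont
  -- `B` covers the compact interval before `t₁`, the last entry shifts the time origin from `t₁` to
  -- `t₀`, and `0` secures the sign.
  refine ⟨max B (max 0 (c * Real.exp (κ * (t₁ - t₀)))),
    le_max_of_le_right (le_max_left _ _), fun t ht => ?_⟩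
  have hpos := Real.exp_pos (-κ * (t - t₀))
  rcases le_total t t₁ with h1 | h1
  · have h2 := hB t ⟨ht, h1⟩
    rw [norm_mul, Real.norm_eq_abs, Real.norm_of_nonneg (Real.exp_pos _).le] at h2
    calc |f t| = |f t| * Real.exp (κ * (t - t₀)) * Real.exp (-κ * (t - t₀)) := by
          rw [mul_assoc, ← Real.exp_add]; simp
      _ ≤ _ := mul_le_mul_of_nonneg_right (h2.trans (le_max_left _ _)) hpos.le
  · calc |f t| ≤ c * Real.exp (-κ * (t - t₁)) := h t h1
      _ = c * Real.exp (κ * (t₁ - t₀)) * Real.exp (-κ * (t - t₀)) := by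
          rw [mul_assoc, ← Real.exp_add]; ring_nf
      _ ≤ _ := mul_le_mul_of_nonneg_right
          ((le_max_right _ _).trans (le_max_right _ _)) hpos.le

/-! ### The linear regression equation and the extended regressor -/

section Regression

variable {n nθ nΘ : ℕ} {sys : SystemClass n nθ nΘ} {θ : Fin nθ → ℝ} {t₀ : ℝ} {u y : ℝ → ℝ}
  {x ξ : ℝ → Fin n → ℝ} {K : Fin n → ℝ} {z : ℝ → Fin n → ℝ}
  {Ω Pf : ℝ → Matrix (Fin n) (Fin n) ℝ}

/-- The parameter of the extended regression equation. -/
def regressionParameter (sys : SystemClass n nθ nΘ) (θ : Fin nθ → ℝ) (ξ₀ : Fin n → ℝ) :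
    RegIdx n → ℝ :=
  Sum.elim (Sum.elim (sys.ψa θ) (sys.ψb θ)) (-ξ₀)

/-- Because `y = C₀ᵀ ξ`, one has `A₀ ξ = A_K ξ + y K`; every input then cancels against a filter,
leaving a homogeneous equation. -/
theorem filter_error_eq (htraj : IsTrajectory sys θ t₀ u y x ξ)
    (hfilter : IsFilter K t₀ u y z Ω Pf) {t : ℝ} (ht : t₀ ≤ t) :
    ξ t - z t - Ω t *ᵥ sys.ψa θ - Pf t *ᵥ sys.ψb θ =
      NormedSpace.exp ((t - t₀) • filterA K) *ᵥ ξ t₀ := by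
  have h : ∀ i, HasRateFrom t₀
      (fun t => (ξ t - z t - Ω t *ᵥ sys.ψa θ - Pf t *ᵥ sys.ψb θ) i)
      (fun t => (filterA K *ᵥ (ξ t - z t - Ω t *ᵥ sys.ψa θ - Pf t *ᵥ sys.ψb θ) + 0) i) := by
    intro i
    have hΩ : HasRateFrom t₀ (fun t => (Ω t *ᵥ sys.ψa θ) i)
        (fun t => ((filterA K * Ω t + y t • 1) *ᵥ sys.ψa θ) i) :=
      (HasRateFrom.sum Finset.univ fun j _ => (hfilter.Ω_rate i j).const_mul (sys.ψa θ j)).congr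
        (fun t _ => by simp only [Matrix.mulVec, dotProduct, mul_comm])
        (fun t _ => by simp only [Matrix.mulVec, dotProduct, mul_comm])
    have hP : HasRateFrom t₀ (fun t => (Pf t *ᵥ sys.ψb θ) i)
        (fun t => ((filterA K * Pf t + u t • 1) *ᵥ sys.ψb θ) i) :=
      (HasRateFrom.sum Finset.univ fun j _ => (hfilter.Pf_rate i j).const_mul (sys.ψb θ j)).congr
        (fun t _ => by simp only [Matrix.mulVec, dotProduct, mul_comm])
        (fun t _ => by simp only [Matrix.mulVec, dotProduct, mul_comm])
    refine ((((htraj.obsState i).sub (hfilter.z_rate i)).sub hΩ).sub hP).congr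
      (fun _ _ => rfl) fun t ht => ?_
    have hshift : shiftA n *ᵥ ξ t = filterA K *ᵥ ξ t + y t • K := by
      rw [filterA, Matrix.sub_mulVec, Matrix.vecMulVec_mulVec, htraj.output_obsState t ht]
      simp
    rw [hshift]
    simp only [Matrix.mulVec_sub, Matrix.add_mulVec, Matrix.smul_mulVec, Matrix.one_mulVec,
      Matrix.mulVec_mulVec, Pi.add_apply, Pi.sub_apply, Pi.zero_apply]
    ring
  ext i
  have h1 := variation_of_constants (f := fun _ => 0) h ht i
  simpa [hfilter.z_init, hfilter.Ω_init, hfilter.Pf_init] using h1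

/-- The transient due to `ξ(t₀)` is part of the regressor, so the regression is exact rather than
valid up to a decaying term. -/
theorem qSignal_eq (htraj : IsTrajectory sys θ t₀ u y x ξ)
    (hfilter : IsFilter K t₀ u y z Ω Pf) {t : ℝ} (ht : t₀ ≤ t) :
    qSignal y z t = regressor K t₀ Ω Pf t ⬝ᵥ regressionParameter sys θ (ξ t₀) := by
  have h := congrArg (fun v => firstC n ⬝ᵥ v) (filter_error_eq htraj hfilter ht)
  simp only [dotProduct_sub] at h
  rw [qSignal, htraj.output_obsState t ht, regressor, regressionParameter,
    sumElim_dotProduct_sumElim, sumElim_dotProduct_sumElim]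
  simp only [Matrix.mulVec_transpose, neg_dotProduct, dotProduct_neg, neg_neg,
    ← Matrix.dotProduct_mulVec]
  linarith

end Regression

section Extension

variable {n : ℕ} {σ t₀ : ℝ} {φ : ℝ → RegIdx n → ℝ} {q : ℝ → ℝ} {qbar : ℝ → RegIdx n → ℝ}
  {φbar : ℝ → Matrix (RegIdx n) (RegIdx n) ℝ}

theorem IsExtension.qbar_eq (hext : IsExtension σ t₀ φ q qbar φbar) {η : RegIdx n → ℝ}
    (hq : ∀ t, t₀ ≤ t → q t = φ t ⬝ᵥ η) {t : ℝ} (ht : t₀ ≤ t) : qbar t = φbar t *ᵥ η := by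
  ext i
  have h1 : HasRateFrom t₀ (fun t => (φbar t *ᵥ η) i)
      (fun t => Real.exp (-σ * (t - t₀)) * (φ t i * q t)) :=
    (HasRateFrom.sum Finset.univ fun j _ => (hext.φ_rate i j).const_mul (η j)).congr
      (fun t _ => by simp only [Matrix.mulVec, dotProduct, mul_comm])
      (fun t ht => by
        rw [hq t ht, dotProduct, Finset.mul_sum, Finset.mul_sum]
        exact Finset.sum_congr rfl fun j _ => by ring)
  have h2 := (h1 t ht).2
  have h3 := (hext.q_rate i t ht).2
  simp only [hext.φ_init, Matrix.zero_mulVec] at h2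
  simp only [hext.q_init] at h3
  rw [h2, h3]

theorem IsExtension.isHermitian (hext : IsExtension σ t₀ φ q qbar φbar) {t : ℝ} (ht : t₀ ≤ t) :
    (φbar t).IsHermitian := by
  ext i j
  have h1 := (hext.φ_rate i j t ht).2
  have h2 := (hext.φ_rate j i t ht).2
  simp only [hext.φ_init] at h1 h2
  simp only [mul_comm (φ _ j)] at h2
  rw [Matrix.conjTranspose_apply, star_trivial, h1, h2]
  rfl

/-- The rate of each quadratic form is a nonnegative square: this is the source of the monotonicity
of `φ̄`, hence of `Δ`. -/
theorem IsExtension.hasRateFrom_quadratic (hext : IsExtension σ t₀ φ q qbar φbar)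
    (v : RegIdx n → ℝ) :
    HasRateFrom t₀ (fun t => v ⬝ᵥ (φbar t *ᵥ v))
      (fun t => Real.exp (-σ * (t - t₀)) * (φ t ⬝ᵥ v) ^ 2) :=
  (HasRateFrom.sum Finset.univ fun i _ => (HasRateFrom.sum Finset.univ fun j _ =>
    (hext.φ_rate i j).const_mul (v j)).const_mul (v i)).congr
    (fun t _ => by simp only [Matrix.mulVec, dotProduct, mul_comm])
    (fun t _ => by
      rw [sq, dotProduct, Finset.sum_mul_sum, Finset.mul_sum]
      refine Finset.sum_congr rfl fun i _ => ?_
      rw [Finset.mul_sum, Finset.mul_sum]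
      exact Finset.sum_congr rfl fun j _ => by ring)

theorem IsExtension.posSemidef_sub (hext : IsExtension σ t₀ φ q qbar φbar) {a b : ℝ}
    (ha : t₀ ≤ a) (hab : a ≤ b) : (φbar b - φbar a).PosSemidef := by
  refine Matrix.PosSemidef.of_dotProduct_mulVec_nonneg
    ((hext.isHermitian (ha.trans hab)).sub (hext.isHermitian ha)) fun v => ?_
  rw [star_trivial, Matrix.sub_mulVec, dotProduct_sub,
    (hext.hasRateFrom_quadratic v).sub_eq ha (ha.trans hab)]
  exact intervalIntegral.integral_nonneg hab fun s _ => by positivity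

theorem IsExtension.posSemidef (hext : IsExtension σ t₀ φ q qbar φbar) {t : ℝ} (ht : t₀ ≤ t) :
    (φbar t).PosSemidef := by
  simpa [hext.φ_init] using hext.posSemidef_sub le_rfl ht

theorem IsExtension.delta_mono (hext : IsExtension σ t₀ φ q qbar φbar) {k : ℝ} (hk : 0 < k)
    {a b : ℝ} (ha : t₀ ≤ a) (hab : a ≤ b) : delta k (φbar a) ≤ delta k (φbar b) :=
  mul_le_mul_of_nonneg_left
    (det_le_det_of_posSemidef_sub (hext.posSemidef ha) (hext.posSemidef_sub ha hab)) hk.le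

/-- On `[tr, te]` the weight is at least `e^{-σ(te - t₀)} > 0`, so excitation bounds the growth of
`φ̄` from below, and `φ̄(tr)` is already positive semidefinite. -/
theorem IsExtension.posDef (hext : IsExtension σ t₀ φ q qbar φbar) (hσ : 0 < σ) {tr te : ℝ}
    (hFE : FinitelyExciting t₀ tr te φ) : (φbar te).PosDef := by
  obtain ⟨htr, hte, α, hα, hpsd⟩ := hFE
  have ht := htr.trans hte.le
  refine Matrix.PosDef.of_dotProduct_mulVec_pos (hext.isHermitian ht) fun v hv => ?_
  rw [star_trivial]
  -- Integrability of the unweighted products comes from the weighted ones by undoing the continuous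
  -- weight.
  have hint : ∀ i j, IntervalIntegrable (fun s => φ s i * φ s j) volume tr te := fun i j =>
    (((hext.φ_rate i j).intervalIntegrable htr ht).continuousOn_mul
      (g := fun s => Real.exp (σ * (s - t₀))) (by fun_prop)).congr fun s _ => by
        change Real.exp (σ * (s - t₀)) * (Real.exp (-σ * (s - t₀)) * (φ s i * φ s j)) = _
        rw [← mul_assoc, ← Real.exp_add]
        simp
  have hsq : ∀ s, (φ s ⬝ᵥ v) ^ 2 = ∑ i, v i * ∑ j, (φ s i * φ s j) * v j := fun s => by
    rw [sq, dotProduct, Finset.sum_mul_sum]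
    refine Finset.sum_congr rfl fun i _ => ?_
    rw [Finset.mul_sum]
    exact Finset.sum_congr rfl fun j _ => by ring
  have hint' : ∀ i, IntervalIntegrable (fun s => ∑ j, (φ s i * φ s j) * v j) volume tr te :=
    fun i => intervalIntegrable_finsetSum Finset.univ fun j _ => (hint i j).mul_const (v j)
  have hint'' : IntervalIntegrable (fun s => (φ s ⬝ᵥ v) ^ 2) volume tr te := by
    simp only [hsq]
    exact intervalIntegrable_finsetSum Finset.univ fun i _ => (hint' i).const_mul (v i)
  have hgram : α * (v ⬝ᵥ v) ≤ ∫ s in tr..te, (φ s ⬝ᵥ v) ^ 2 := by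
    have h1 := hpsd.dotProduct_mulVec_nonneg v
    rw [star_trivial, Matrix.sub_mulVec, dotProduct_sub, Matrix.smul_mulVec, Matrix.one_mulVec,
      dotProduct_smul, smul_eq_mul, sub_nonneg] at h1
    refine h1.trans_eq ?_
    simp only [hsq]
    rw [intervalIntegral.integral_finsetSum fun i _ => (hint' i).const_mul (v i)]
    simp only [dotProduct, Matrix.mulVec, Matrix.of_apply]
    refine Finset.sum_congr rfl fun i _ => ?_
    rw [intervalIntegral.integral_const_mul,
      intervalIntegral.integral_finsetSum fun j _ => (hint i j).mul_const (v j)]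
    simp only [intervalIntegral.integral_mul_const]
  have hpos : 0 < v ⬝ᵥ v := by
    have := Matrix.dotProduct_star_self_pos_iff.2 hv
    simpa using this
  have hrate := hext.hasRateFrom_quadratic v
  have hle : Real.exp (-σ * (te - t₀)) * ∫ s in tr..te, (φ s ⬝ᵥ v) ^ 2 ≤
      ∫ s in tr..te, Real.exp (-σ * (s - t₀)) * (φ s ⬝ᵥ v) ^ 2 := by
    rw [← intervalIntegral.integral_const_mul]
    refine intervalIntegral.integral_mono_on hte.le (hint''.const_mul _)
      (hrate.intervalIntegrable htr ht) fun s hs => ?_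
    refine mul_le_mul_of_nonneg_right (Real.exp_le_exp.2 ?_) (sq_nonneg _)
    nlinarith [hs.2]
  have h2 := hrate.sub_eq htr ht
  have h3 : 0 ≤ v ⬝ᵥ (φbar tr *ᵥ v) := by
    simpa using (hext.posSemidef htr).dotProduct_mulVec_nonneg v
  have h4 : 0 < Real.exp (-σ * (te - t₀)) * ∫ s in tr..te, (φ s ⬝ᵥ v) ^ 2 :=
    mul_pos (Real.exp_pos _) ((mul_pos hα hpos).trans_le hgram)
  linarith

/-- The adjugate decouples the regression into `det φ̄ · η`, and `[I 0]` discards the block of `η`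
holding the initial state. -/
theorem IsExtension.calY_eq {nθ nΘ : ℕ} {sys : SystemClass n nθ nΘ} {θ : Fin nθ → ℝ}
    {ξ₀ : Fin n → ℝ} (hext : IsExtension σ t₀ φ q qbar φbar)
    (hq : ∀ t, t₀ ≤ t → q t = φ t ⬝ᵥ regressionParameter sys θ ξ₀) (k : ℝ) {t : ℝ}
    (ht : t₀ ≤ t) :
    calY sys k (φbar t) (qbar t) = delta k (φbar t) • sys.ψab θ := by
  rw [calY, hext.qbar_eq hq ht, Matrix.mulVec_mulVec _ (φbar t).adjugate, Matrix.adjugate_mul,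
    Matrix.smul_mulVec, Matrix.one_mulVec, Matrix.mulVec_smul, Matrix.mulVec_smul, smul_smul,
    delta, SystemClass.ψab, regressionParameter, Matrix.fromCols_mulVec_sumElim,
    Matrix.one_mulVec, Matrix.zero_mulVec, add_zero]

end Extension

/-! ### The error equations of the observer -/

theorem kronRegressor_mulVec_stackAB {n nθ nΘ : ℕ} (sys : SystemClass n nθ nΘ) (θ : Fin nθ → ℝ)
    (x : Fin n → ℝ) (u : ℝ) :
    kronRegressor x u *ᵥ sys.stackAB θ = sys.A θ *ᵥ x + u • sys.B θ := by
  ext i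
  simp [kronRegressor, SystemClass.stackAB, Matrix.mulVec, dotProduct, Fintype.sum_sum_type,
    Fintype.sum_prod_type, ite_mul, Finset.sum_ite_irrel, mul_comm]

theorem ΦT_mulVec_ΘAB {n nθ nΘ : ℕ} {sys : SystemClass n nθ nΘ} {θ : Fin nθ → ℝ}
    (hdup : sys.Dphi *ᵥ sys.ΘAB θ = sys.stackAB θ) (x : Fin n → ℝ) (u : ℝ) :
    sys.ΦT x u *ᵥ sys.ΘAB θ = sys.A θ *ᵥ x + u • sys.B θ := by
  rw [SystemClass.ΦT, ← Matrix.mulVec_mulVec, hdup, kronRegressor_mulVec_stackAB]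

theorem exists_norm_le_exp_of_apply {n : ℕ} {t₀ κ : ℝ} {v : ℝ → Fin n → ℝ}
    (h : ∀ i, ∃ c : ℝ, 0 ≤ c ∧ ∀ t, t₀ ≤ t → |v t i| ≤ c * Real.exp (-κ * (t - t₀))) :
    ∃ c : ℝ, ∀ t, t₀ ≤ t → ‖v t‖ ≤ c * Real.exp (-κ * (t - t₀)) := by
  choose c hc hv using h
  refine ⟨∑ i, c i, fun t ht => ?_⟩
  have hpos := Real.exp_pos (-κ * (t - t₀))
  refine (pi_norm_le_iff_of_nonneg
    (mul_nonneg (Finset.sum_nonneg fun i _ => hc i) hpos.le)).2 fun i => ?_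
  exact (hv i t ht).trans (mul_le_mul_of_nonneg_right
    (Finset.single_le_sum (fun i _ => hc i) (Finset.mem_univ i)) hpos.le)

/-- Young's inequality for `e^{-(γ - κ)s}` and `e^{γ s}|f|`: it trades weighted square integrability
at rate `γ` for weighted integrability at a smaller rate `κ`. -/
theorem exp_mul_abs_le {γ κ s f : ℝ} : Real.exp (κ * s) * |f| ≤
    Real.exp (-(2 * (γ - κ)) * s) + Real.exp (2 * γ * s) * f ^ 2 / 2 := by
  have h1 : Real.exp (κ * s) = Real.exp (-(γ - κ) * s) * Real.exp (γ * s) := by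
    rw [← Real.exp_add]; ring_nf
  have h2 : Real.exp (-(2 * (γ - κ)) * s) = Real.exp (-(γ - κ) * s) ^ 2 := by
    rw [← Real.exp_nat_mul]; ring_nf
  have h3 : Real.exp (2 * γ * s) = Real.exp (γ * s) ^ 2 := by
    rw [← Real.exp_nat_mul]; ring_nf
  rw [h1, h2, h3, ← sq_abs f]
  nlinarith [sq_nonneg (Real.exp (-(γ - κ) * s) - Real.exp (γ * s) * |f|),
    sq_nonneg (Real.exp (-(γ - κ) * s))]

section Errors

variable {n nθ nΘ : ℕ} {sys : SystemClass n nθ nΘ} {m : KnownMaps n nθ nΘ} {θ : Fin nθ → ℝ}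
  {L : Fin n → ℝ} {t₀ t₁ am γ₀ γ₁ ρ : ℝ} {u y Δ : ℝ → ℝ} {x ξ : ℝ → Fin n → ℝ}
  {Y : ℝ → Fin nθ → ℝ} {xh : ℝ → Fin n → ℝ} {Θh : ℝ → Fin nΘ → ℝ} {Lh : ℝ → Fin n → ℝ}

/-- Adding and subtracting `Φᵀ(x̂, u) Θ_AB` and `L ỹ` makes the true gain act on the error, since `ỹ
= 𝒞ᵀ(x̂ - x)`. -/
theorem IsObserver.hasRateFrom_state_error
    (hobs : IsObserver sys m am γ₀ γ₁ ρ t₀ u y Δ Y xh Θh Lh)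
    (htraj : IsTrajectory sys θ t₀ u y x ξ) (hdup : sys.Dphi *ᵥ sys.ΘAB θ = sys.stackAB θ)
    (i : Fin n) :
    HasRateFrom t₀ (fun t => (xh t - x t) i)
      (fun t => ((sys.A θ - Matrix.vecMulVec L sys.outC) *ᵥ (xh t - x t) +
        (sys.ΦT (xh t) (u t) *ᵥ (Θh t - sys.ΘAB θ) -
          (sys.outC ⬝ᵥ xh t - y t) • (Lh t - L))) i) := by
  refine ((hobs.state i).sub (htraj.state i)).congr (fun _ _ => rfl) fun t ht => ?_
  rw [Matrix.mulVec_sub _ (Θh t), ΦT_mulVec_ΘAB hdup, Matrix.sub_mulVec,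
    Matrix.vecMulVec_mulVec, dotProduct_sub, ← htraj.output_state t ht, Matrix.mulVec_sub]
  simp only [Pi.add_apply, Pi.sub_apply, Pi.smul_apply, smul_eq_mul, MulOpposite.smul_eq_mul_unop,
    MulOpposite.unop_op]
  ring

/-- Division by `ℳ_AB²` in the gain cancels the regression scalar, so its size does not enter the
rate. -/
theorem IsObserver.hasRateFrom_Θ_error
    (hobs : IsObserver sys m am γ₀ γ₁ ρ t₀ u y Δ Y xh Θh Lh)
    (hΘ : ThetaHeterogeneous sys m) (hident : Identifiable sys m θ) (ht₁ : t₀ ≤ t₁)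
    (hρ : 0 < ρ) (hΔ : ∀ t, t₁ ≤ t → ρ ≤ Δ t) (hY : ∀ t, t₁ ≤ t → Y t = Δ t • sys.ψab θ)
    (i : Fin nΘ) :
    HasRateFrom t₁ (fun t => Θh t i - sys.ΘAB θ i)
      (fun t => -(γ₁ + γ₀ * lambdaMax ((sys.ΦT (xh t) (u t))ᵀ * sys.ΦT (xh t) (u t))) *
        (Θh t i - sys.ΘAB θ i)) := by
  refine (((hobs.lawΘ i).mono ht₁).sub (HasRateFrom.const (sys.ΘAB θ i))).congr
    (fun _ _ => rfl) fun t ht => ?_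
  have hM := hΘ.MAB_ne_zero hident (hρ.trans_le (hΔ t ht)) (hY t ht)
  rw [gainΘ, if_neg (hΔ t ht).not_gt, hΘ.YAB_eq hident (hY t ht), Pi.smul_apply, smul_eq_mul]
  field_simp
  ring

theorem IsObserver.hasRateFrom_L_error
    (hobs : IsObserver sys m am γ₀ γ₁ ρ t₀ u y Δ Y xh Θh Lh)
    (hgain : LuenbergerGain sys m am θ L) (hident : Identifiable sys m θ) (ht₁ : t₀ ≤ t₁)
    (hρ : 0 < ρ) (hΔ : ∀ t, t₁ ≤ t → ρ ≤ Δ t) (hY : ∀ t, t₁ ≤ t → Y t = Δ t • sys.ψab θ)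
    (i : Fin n) :
    HasRateFrom t₁ (fun t => Lh t i - L i)
      (fun t => -(γ₁ + γ₀ * (sys.outC ⬝ᵥ xh t - y t) ^ 2) * (Lh t i - L i)) := by
  refine (((hobs.lawL i).mono ht₁).sub (HasRateFrom.const (L i))).congr
    (fun _ _ => rfl) fun t ht => ?_
  have hM := hgain.ML_ne_zero hident (hρ.trans_le (hΔ t ht)) (hY t ht)
  rw [gainL, if_neg (hΔ t ht).not_gt, hgain.YL_eq hident (hY t ht), Pi.smul_apply, smul_eq_mul]
  field_simp
  ring

/-- The forcing term of the state error equation is damped by the two normalized gains. -/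
theorem IsObserver.exists_abs_state_error_le
    (hobs : IsObserver sys m am γ₀ γ₁ ρ t₀ u y Δ Y xh Θh Lh)
    (htraj : IsTrajectory sys θ t₀ u y x ξ) (hdup : sys.Dphi *ᵥ sys.ΘAB θ = sys.stackAB θ)
    (hΘ : ThetaHeterogeneous sys m) (hgain : LuenbergerGain sys m am θ L)
    (hident : Identifiable sys m θ) (ht₁ : t₀ ≤ t₁)
    (hρ : 0 < ρ) (hΔ : ∀ t, t₁ ≤ t → ρ ≤ Δ t) (hY : ∀ t, t₁ ≤ t → Y t = Δ t • sys.ψab θ)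
    (hγ₀ : 0 < γ₀) {κ : ℝ} (hκ : κ < am) (hκ' : κ < γ₁) :
    ∃ c : ℝ, ∀ t, t₁ ≤ t → ∀ i, |(xh t - x t) i| ≤ c * Real.exp (-κ * (t - t₁)) := by
  set lam : ℝ → ℝ := fun t => lambdaMax ((sys.ΦT (xh t) (u t))ᵀ * sys.ΦT (xh t) (u t)) with hlam
  set yt : ℝ → ℝ := fun t => sys.outC ⬝ᵥ xh t - y t with hyt
  have hΘe := hobs.hasRateFrom_Θ_error hΘ hident ht₁ hρ hΔ hY
  have hLe := hobs.hasRateFrom_L_error hgain hident ht₁ hρ hΔ hY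
  set gΘ : Fin nΘ → ℝ → ℝ := fun j t =>
    Real.exp (2 * γ₁ * (t - t₁)) * (lam t * (Θh t j - sys.ΘAB θ j) ^ 2) with hgΘ
  set gL : Fin n → ℝ → ℝ := fun j t =>
    Real.exp (2 * γ₁ * (t - t₁)) * (yt t ^ 2 * (Lh t j - L j) ^ 2) with hgL
  set gE : ℝ → ℝ := fun t => Real.exp (-(2 * (γ₁ - κ)) * (t - t₁)) with hgE
  have hgL0 : ∀ j t, 0 ≤ gL j t := fun j t => by positivity
  refine exists_abs_le_exp_of_forced hgain.charpoly hκ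
    (fun i => (hobs.hasRateFrom_state_error (L := L) htraj hdup i).mono ht₁)
    (g := fun t => gE t + ((∑ j, gΘ j t) + ∑ j, gL j t))
    (H := 1 / (2 * (γ₁ - κ)) + ((∑ j, (Θh t₁ j - sys.ΘAB θ j) ^ 2 / (2 * γ₀)) +
      ∑ j, (Lh t₁ j - L j) ^ 2 / (2 * γ₀))) ?_ ?_
  · intro t _ i
    refine (exp_mul_abs_le (γ := γ₁)).trans (add_le_add_right ?_ _)
    have h1 : (sys.ΦT (xh t) (u t) *ᵥ (Θh t - sys.ΘAB θ)) i ^ 2 ≤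
        lam t * ∑ j, (Θh t j - sys.ΘAB θ j) ^ 2 := sq_mulVec_le_lambdaMax _ _ i
    have h2 : Real.exp (2 * γ₁ * (t - t₁)) * (yt t * (Lh t i - L i)) ^ 2 ≤ ∑ j, gL j t := by
      rw [mul_pow]
      exact Finset.single_le_sum (f := fun j => gL j t) (fun j _ => hgL0 j t) (Finset.mem_univ i)
    have h3 : Real.exp (2 * γ₁ * (t - t₁)) *
        (sys.ΦT (xh t) (u t) *ᵥ (Θh t - sys.ΘAB θ)) i ^ 2 ≤ ∑ j, gΘ j t := by
      simp only [hgΘ]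
      rw [← Finset.mul_sum, ← Finset.mul_sum]
      exact mul_le_mul_of_nonneg_left h1 (Real.exp_pos _).le
    -- The `1/2` left by Young's inequality exactly absorbs the factor `2` from squaring a
    -- difference.
    have h4 : ∀ a b : ℝ, (a - b) ^ 2 / 2 ≤ a ^ 2 + b ^ 2 := fun a b => by
      nlinarith [sq_nonneg (a + b)]
    have h5 := mul_le_mul_of_nonneg_left
      (h4 ((sys.ΦT (xh t) (u t) *ᵥ (Θh t - sys.ΘAB θ)) i) (yt t * (Lh t i - L i)))
      (Real.exp_pos (2 * γ₁ * (t - t₁))).le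
    rw [Pi.sub_apply, Pi.smul_apply, Pi.sub_apply, smul_eq_mul, mul_div_assoc]
    linarith
  · intro t ht
    have hiE : IntervalIntegrable gE volume t₁ t :=
      Continuous.intervalIntegrable (by fun_prop) _ _
    have hiΘ := fun j => integral_damping_le hγ₀ (hΘe j) ht
    have hiL := fun j => integral_damping_le hγ₀ (hLe j) ht
    have hsΘ : IntervalIntegrable (fun t => ∑ j, gΘ j t) volume t₁ t :=
      intervalIntegrable_finsetSum Finset.univ fun j _ => (hiΘ j).1
    have hsL : IntervalIntegrable (fun t => ∑ j, gL j t) volume t₁ t :=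
      intervalIntegrable_finsetSum Finset.univ fun j _ => (hiL j).1
    refine ⟨hiE.add (hsΘ.add hsL), ?_⟩
    rw [intervalIntegral.integral_add hiE (hsΘ.add hsL), intervalIntegral.integral_add hsΘ hsL,
      intervalIntegral.integral_finsetSum fun j _ => (hiΘ j).1,
      intervalIntegral.integral_finsetSum fun j _ => (hiL j).1]
    exact add_le_add (integral_exp_neg_le (by linarith)) (add_le_add
      (Finset.sum_le_sum fun j _ => (hiΘ j).2) (Finset.sum_le_sum fun j _ => (hiL j).2))

end Errors

end AdaptiveObserver

end

theorem theorem1 {n nθ nΘ : ℕ} (sys : AdaptiveObserver.SystemClass n nθ nΘ)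
    (m : AdaptiveObserver.KnownMaps n nθ nΘ)
    (θ : Fin nθ → ℝ) (L : (Fin nθ → ℝ) → Fin n → ℝ) (t₀ am k σ γ₀ γ₁ : ℝ) (K : Fin n → ℝ)
    (u y : ℝ → ℝ) (x ξ : ℝ → Fin n → ℝ)
    (z : ℝ → Fin n → ℝ) (Ω Pf : ℝ → Matrix (Fin n) (Fin n) ℝ)
    (qbar : ℝ → AdaptiveObserver.RegIdx n → ℝ)
    (φbar : ℝ → Matrix (AdaptiveObserver.RegIdx n) (AdaptiveObserver.RegIdx n) ℝ)
    (tr te : ℝ)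
    -- the system; `Θ_AB` retains all of `(A, B)`
    (hdup : sys.Dphi.mulVec (sys.ΘAB θ) = sys.stackAB θ)
    (htraj : AdaptiveObserver.IsTrajectory sys θ t₀ u y x ξ)
    -- the four assumptions
    (hbdd : ∃ M : ℝ, ∀ t, t₀ ≤ t → ‖x t‖ ≤ M ∧ ‖ξ t‖ ≤ M)
    (hΘ : AdaptiveObserver.ThetaHeterogeneous sys m)
    (hident : AdaptiveObserver.Identifiable sys m θ)
    (ham : 0 < am) (hgain : AdaptiveObserver.LuenbergerGain sys m am θ (L θ))
    -- design parameters, filters and extended signals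
    (hk : 0 < k) (hσ : 0 < σ) (hγ₀ : 0 < γ₀) (hγ₁ : 0 < γ₁)
    (hK : AdaptiveObserver.IsHurwitz (AdaptiveObserver.filterA K))
    (hfilter : AdaptiveObserver.IsFilter K t₀ u y z Ω Pf)
    (hext : AdaptiveObserver.IsExtension σ t₀ (AdaptiveObserver.regressor K t₀ Ω Pf)
      (AdaptiveObserver.qSignal y z) qbar φbar)
    -- finite excitation
    (hFE : AdaptiveObserver.FinitelyExciting t₀ tr te (AdaptiveObserver.regressor K t₀ Ω Pf)) :
    -- `Δ` is bounded below by a positive constant from `te` on, so thresholds `ρ` exist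
    (0 < AdaptiveObserver.delta k (φbar te) ∧
      ∀ t, te ≤ t → AdaptiveObserver.delta k (φbar te) ≤ AdaptiveObserver.delta k (φbar t)) ∧
    -- for every positive threshold that `Δ` reaches, both errors vanish exponentially
    ∃ κ : ℝ, 0 < κ ∧ ∀ ρ : ℝ, 0 < ρ → (∃ t, t₀ ≤ t ∧ ρ ≤ AdaptiveObserver.delta k (φbar t)) →
      ∀ (xh : ℝ → Fin n → ℝ) (Θh : ℝ → Fin nΘ → ℝ) (Lh : ℝ → Fin n → ℝ),
        AdaptiveObserver.IsObserver sys m am γ₀ γ₁ ρ t₀ u y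
          (fun t => AdaptiveObserver.delta k (φbar t))
          (fun t => AdaptiveObserver.calY sys k (φbar t) (qbar t)) xh Θh Lh →
        ∃ c : ℝ, ∀ t, t₀ ≤ t →
          ‖xh t - x t‖ ≤ c * Real.exp (-κ * (t - t₀)) ∧
          ‖Θh t - sys.ΘAB θ‖ ≤ c * Real.exp (-κ * (t - t₀)) := by
  open AdaptiveObserver in
  have hq : ∀ t, t₀ ≤ t → qSignal y z t =
      regressor K t₀ Ω Pf t ⬝ᵥ regressionParameter sys θ (ξ t₀) :=
    fun t ht => qSignal_eq htraj hfilter ht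
  have hte : t₀ ≤ te := hFE.1.trans hFE.2.1.le
  refine ⟨⟨mul_pos hk (hext.posDef hσ hFE).det_pos, fun t ht => hext.delta_mono hk hte ht⟩,
    min am γ₁ / 2, by positivity, ?_⟩
  have hmin : 0 < min am γ₁ := lt_min ham hγ₁
  -- Halving gives strict inequality with both rates: one absorbs the polynomial factor in the
  -- matrix exponential, the other serves Young's inequality.
  have hκ : min am γ₁ / 2 < am := (half_lt_self hmin).trans_le (min_le_left _ _)
  have hκ' : min am γ₁ / 2 < γ₁ := (half_lt_self hmin).trans_le (min_le_right _ _)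
  set κ := min am γ₁ / 2
  rintro ρ hρ ⟨t₁, ht₁, hρt₁⟩ xh Θh Lh hobs
  -- Monotonicity of `Δ` keeps the gains on after `t₁`. The threshold `ρ` affects only `t₁`, hence
  -- the constant and not the rate.
  have hΔ : ∀ t, t₁ ≤ t → ρ ≤ AdaptiveObserver.delta k (φbar t) := fun t ht =>
    hρt₁.trans (hext.delta_mono hk ht₁ ht)
  have hY : ∀ t, t₁ ≤ t → AdaptiveObserver.calY sys k (φbar t) (qbar t) =
      AdaptiveObserver.delta k (φbar t) • sys.ψab θ := fun t ht =>
    hext.calY_eq hq k (ht₁.trans ht)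
  obtain ⟨c, hc⟩ := hobs.exists_abs_state_error_le htraj hdup hΘ hgain hident ht₁ hρ hΔ hY hγ₀
    hκ hκ'
  obtain ⟨c₁, hc₁⟩ := AdaptiveObserver.exists_norm_le_exp_of_apply (v := fun t => xh t - x t)
    (t₀ := t₀) (κ := κ) fun i =>
      (hobs.hasRateFrom_state_error (L := L θ) htraj hdup i).exists_abs_le_exp
        fun t ht => hc t ht i
  obtain ⟨c₂, hc₂⟩ := AdaptiveObserver.exists_norm_le_exp_of_apply
    (v := fun t => Θh t - sys.ΘAB θ) (t₀ := t₀) (κ := κ) fun i =>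
      ((hobs.lawΘ i).sub (AdaptiveObserver.HasRateFrom.const (sys.ΘAB θ i))).exists_abs_le_exp
        fun t ht => (AdaptiveObserver.abs_le_of_damped hγ₀
          (fun t => AdaptiveObserver.lambdaMax_gram_nonneg _)
          (hobs.hasRateFrom_Θ_error hΘ hident ht₁ hρ hΔ hY i) ht).trans
          (mul_le_mul_of_nonneg_left (Real.exp_le_exp.2
            (mul_le_mul_of_nonneg_right (neg_le_neg hκ'.le) (sub_nonneg.2 ht))) (abs_nonneg _))
  refine ⟨max c₁ c₂, fun t ht => ⟨(hc₁ t ht).trans ?_, (hc₂ t ht).trans ?_⟩⟩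
  · exact mul_le_mul_of_nonneg_right (le_max_left _ _) (Real.exp_pos _).le
  · exact mul_le_mul_of_nonneg_right (le_max_right _ _) (Real.exp_pos _).le
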